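/- **Setting.** For $0\le\eta\le 1/2$ and $S\subseteq[M]$ let $U_M^{S,\eta}$ be the product distribution on $\{0,1\}^M$ whose $i$-th coordinate has mean $1/2+\eta$ if $i\in S$ and $1/2$ otherwise. Let $d_{\mathrm{TV}}(P,Q)=\sup_E|P(E)-Q(E)|$. A statistical query of tolerance $t>0$ to a distribution $P$ on $\{0,1\}^M$ is a function $f:\{0,1\}^M\to[-1,1]$; a STAT oracle for $P$ answers it with some $v$ such that $|v-\mathbf{E}_P[f]|\le t$. An SQ algorithm is a (randomized) algorithm that adaptively makes such queries and then outputs a distribution $Q$ on $\{0,1\}^M$. **Theorem (SQ lower bound for robust learning of a binary product distribution in total variation).** There are an integer $k_0$ and universal constants $a_0,\kappa,c>0$ such that for every $b>0$ there is a $C'>0$ (depending only on $b$) for which the following holds. Let $k\ge k_0$ and let $m,M$ be positive integers with $M=3m^{5/4}$. Let $0<\epsilon<1/2$, let $\delta=a\,\epsilon\sqrt{\log(1/\epsilon)}/k^2$ with $0<a\le a_0$, let $\tau\ge b\,M^{-(k+1)/5}\delta$ (in particular $\tau=\Theta(M^{-(k+1)/5}\delta)$ with any hidden constant at least $b$ is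 allowed), and assume $$m>\max\Big(\frac{C'}{\epsilon},\ \frac{k^2}{\log(1/\delta)}\Big).$$ Suppose that an SQ algorithm, given access through a STAT oracle to an arbitrary distribution $P$ on $\{0,1\}^M$ with $d_{\mathrm{TV}}\big(P,U_M^{S,\delta/\sqrt m}\big)\le\epsilon$ for some unknown $S\subseteq[M]$ with $|S|=m$, outputs with probability at least $2/3$ (for every such $P$ and every STAT oracle for $P$) a hypothesis $Q$ with $d_{\mathrm{TV}}(Q,P)\le\kappa\delta$. Then the algorithm must either make queries of tolerance smaller than $\sqrt{2\tau}$ or make at least $$2^{\,c\,M^{2/5}}\,M^{-(k+1)/5}$$ statistical queries; that is, for some such $P$ and some STAT oracle for $P$, with positive probability over its internal randomness it does one or the other. -/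

import Mathlib

/-- The Boolean cube `{0,1}^M`. -/
abbrev Cube (M : ℕ) : Type := Fin M → Bool

/-- Total variation distance between two distributions on the cube:
the supremum over all events of the difference of the probabilities. -/
noncomputable def tvDist {M : ℕ} (P Q : PMF (Cube M)) : ℝ :=
  ⨆ s : Set (Cube M), |P.toMeasure.real s - Q.toMeasure.real s|

/-- The expectation of `f` under a distribution on the (finite) cube. -/
noncomputable def expect {M : ℕ} (P : PMF (Cube M)) (f : Cube M → ℝ) : ℝ :=
  ∑ x, (P x).toReal * f x

/-- The masses of a product distribution on the cube add up to one. -/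
theorem sum_prod_bernoulli {M : ℕ} (μ : Fin M → unitInterval) :
    ∑ x : Cube M, ∏ i, ENNReal.ofReal (if x i then (μ i : ℝ) else 1 - (μ i : ℝ)) = 1 := by
  have h := Finset.prod_univ_sum (fun _ : Fin M => (Finset.univ : Finset Bool))
    (fun i b => ENNReal.ofReal (if b then (μ i : ℝ) else 1 - (μ i : ℝ)))
  rw [Fintype.piFinset_univ] at h
  rw [← h]
  refine Finset.prod_eq_one fun i _ => ?_
  have h1 : (0 : ℝ) ≤ 1 - (μ i : ℝ) := sub_nonneg.2 (μ i).2.2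
  simp [← ENNReal.ofReal_add (μ i).2.1 h1]

/-- The binary product distribution with mean vector `μ`: the coordinates are independent and
the `i`-th one equals `1` (`true`) with probability `μ i`. -/
noncomputable def binaryProduct {M : ℕ} (μ : Fin M → unitInterval) : PMF (Cube M) :=
  PMF.ofFintype (fun x => ∏ i, ENNReal.ofReal (if x i then (μ i : ℝ) else 1 - (μ i : ℝ)))
    (sum_prod_bernoulli μ)

/-- The product distribution `U_M^{S,η}` whose coordinates have mean `1/2 + η` on `S` and mean
`1/2` off `S`. It is meant for `0 ≤ η ≤ 1/2`; `Set.projIcc 0 1` is the identity there. -/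
noncomputable def shiftedUniform (M : ℕ) (S : Finset (Fin M)) (η : ℝ) : PMF (Cube M) :=
  binaryProduct fun i => Set.projIcc (0 : ℝ) 1 zero_le_one (if i ∈ S then 1 / 2 + η else 1 / 2)

/-- The `ε`-corruptions of the distributions `U_M^{S,η}`, where `S` runs over all sets of `m`
coordinates. -/
def corruptedClass (M m : ℕ) (η ε : ℝ) : Set (PMF (Cube M)) :=
  {P | ∃ S : Finset (Fin M), S.card = m ∧ tvDist P (shiftedUniform M S η) ≤ ε}

/-- A statistical query: a function with values in `[-1,1]`, with the tolerance that is asked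
for. -/
structure StatQuery (M : ℕ) where
  /-- the query function -/
  f : Cube M → ℝ
  /-- the tolerance (accuracy) of the query -/
  tol : ℝ
  bounded : ∀ x, f x ∈ Set.Icc (-1 : ℝ) 1
  tol_pos : 0 < tol

/-- `O` is a `STAT` oracle for `P`: it answers every query up to the tolerance of the query. -/
def IsStatOracle {M : ℕ} (P : PMF (Cube M)) (O : StatQuery M → ℝ) : Prop :=
  ∀ q : StatQuery M, |O q - expect P q.f| ≤ q.tol

/-- A deterministic adaptive statistical query algorithm: it either stops with a hypothesis
distribution, or asks a query and goes on in a way that depends on the answer. -/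
inductive SQAlg (M : ℕ) : Type
  | halt (Q : PMF (Cube M)) : SQAlg M
  | ask (q : StatQuery M) (next : ℝ → SQAlg M) : SQAlg M

namespace SQAlg

/-- The hypothesis that the algorithm outputs when its queries are answered by `O`. -/
noncomputable def output {M : ℕ} : SQAlg M → (StatQuery M → ℝ) → PMF (Cube M)
  | halt Q, _ => Q
  | ask q next, O => output (next (O q)) O

/-- The list of the queries that the algorithm makes when they are answered by `O`. -/
noncomputable def queries {M : ℕ} : SQAlg M → (StatQuery M → ℝ) → List (StatQuery M)
  | halt _, _ => []
  | ask q next, O => q :: queries (next (O q)) O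

end SQAlg

open MeasureTheory in
/-- The randomized algorithm `A` (its random seed `ω` has the law `ν`) learns every distribution
of the class `𝒟` within total variation distance `err`, with probability at least `p`: this
holds for every distribution of the class and every `STAT` oracle for it. (The measurable event
`E` only serves to speak of a probability when the set of good seeds is not measurable.) -/
def LearnsWithProb {M : ℕ} {Ω : Type*} [MeasurableSpace Ω] (ν : Measure Ω) (A : Ω → SQAlg M)
    (𝒟 : Set (PMF (Cube M))) (err p : ℝ) : Prop :=
  ∀ P ∈ 𝒟, ∀ O : StatQuery M → ℝ, IsStatOracle P O →
    ∃ E : Set Ω, MeasurableSet E ∧ p ≤ ν.real E ∧ ∀ ω ∈ E, tvDist ((A ω).output O) P ≤ err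

/-! ### Fourier analysis on the cube -/

/-- The sign `±1` of a bit. -/
def sgn (b : Bool) : ℝ := if b then 1 else -1

@[simp] theorem sgn_true : sgn true = 1 := rfl
@[simp] theorem sgn_false : sgn false = -1 := rfl

theorem sgn_mul_self (b : Bool) : sgn b * sgn b = 1 := by cases b <;> simp

theorem abs_sgn (b : Bool) : |sgn b| = 1 := by cases b <;> simp

/-- The uniform average of a function on the cube. -/
noncomputable def avg {n : ℕ} (φ : Cube n → ℝ) : ℝ := (∑ x, φ x) / 2 ^ n

/-- The character (parity function) of a set of coordinates. -/
noncomputable def chi {n : ℕ} (A : Finset (Fin n)) (x : Cube n) : ℝ := ∏ i ∈ A, sgn (x i)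

/-- The Fourier coefficients of a function on the cube. -/
noncomputable def fhat {n : ℕ} (g : Cube n → ℝ) (A : Finset (Fin n)) : ℝ :=
  avg fun x => g x * chi A x

section avg

variable {n : ℕ}

theorem sum_cube_prod {R : Type*} [CommSemiring R] (h : Fin n → Bool → R) :
    ∑ x : Cube n, ∏ i, h i (x i) = ∏ i, (h i true + h i false) := by
  have := Finset.prod_univ_sum (fun _ : Fin n => (Finset.univ : Finset Bool)) h
  rw [Fintype.piFinset_univ] at this
  rw [← this]
  simp

theorem avg_prod (h : Fin n → Bool → ℝ) :
    avg (fun x => ∏ i, h i (x i)) = ∏ i, (h i true + h i false) / 2 := by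
  rw [avg, sum_cube_prod, Finset.prod_div_distrib]
  simp

theorem avg_add (φ ψ : Cube n → ℝ) : avg (fun x => φ x + ψ x) = avg φ + avg ψ := by
  simp [avg, Finset.sum_add_distrib, add_div]

theorem avg_sub (φ ψ : Cube n → ℝ) : avg (fun x => φ x - ψ x) = avg φ - avg ψ := by
  simp [avg, Finset.sum_sub_distrib, sub_div]

theorem avg_const_mul (c : ℝ) (φ : Cube n → ℝ) : avg (fun x => c * φ x) = c * avg φ := by
  simp [avg, ← Finset.mul_sum, mul_div_assoc]

theorem avg_sum {ι : Type*} (s : Finset ι) (φ : ι → Cube n → ℝ) :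
    avg (fun x => ∑ i ∈ s, φ i x) = ∑ i ∈ s, avg (φ i) := by
  simp only [avg]
  rw [Finset.sum_comm, Finset.sum_div]

theorem avg_one : avg (fun _ : Cube n => (1 : ℝ)) = 1 := by
  simp [avg]

theorem avg_mono {φ ψ : Cube n → ℝ} (h : ∀ x, φ x ≤ ψ x) : avg φ ≤ avg ψ := by
  unfold avg
  gcongr
  exact h _

theorem avg_nonneg {φ : Cube n → ℝ} (h : ∀ x, 0 ≤ φ x) : 0 ≤ avg φ :=
  div_nonneg (Finset.sum_nonneg fun x _ => h x) (by positivity)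

theorem abs_avg_le (φ : Cube n → ℝ) : |avg φ| ≤ avg fun x => |φ x| := by
  rw [avg, abs_div, abs_of_pos (by positivity : (0 : ℝ) < 2 ^ n)]
  unfold avg
  gcongr
  exact Finset.abs_sum_le_sum_abs _ _

theorem avg_mul_sq_le (φ ψ : Cube n → ℝ) :
    (avg fun x => φ x * ψ x) ^ 2 ≤ (avg fun x => φ x ^ 2) * avg fun x => ψ x ^ 2 := by
  unfold avg
  rw [div_pow, div_mul_div_comm, ← pow_two]
  gcongr
  exact Finset.sum_mul_sq_le_sq_mul_sq _ _ _

theorem avg_abs_sq_le (φ : Cube n → ℝ) : (avg fun x => |φ x|) ^ 2 ≤ avg fun x => φ x ^ 2 := by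
  have := avg_mul_sq_le (fun x => |φ x|) (fun _ => 1)
  simpa [avg_one] using this

theorem avg_comp_perm (σ : Equiv.Perm (Fin n)) (φ : Cube n → ℝ) :
    avg (fun x => φ (x ∘ σ)) = avg φ := by
  unfold avg
  congr 1
  exact (Equiv.arrowCongr σ.symm (Equiv.refl Bool)).sum_comp φ

end avg

section characters

variable {n : ℕ}

theorem chi_empty (x : Cube n) : chi ∅ x = 1 := by simp [chi]

theorem abs_chi (A : Finset (Fin n)) (x : Cube n) : |chi A x| = 1 := by
  simp [chi, Finset.abs_prod, abs_sgn]

theorem avg_chi_mul_chi (A B : Finset (Fin n)) :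
    avg (fun x => chi A x * chi B x) = if A = B then 1 else 0 := by
  have h : ∀ x : Cube n, chi A x * chi B x =
      ∏ i, ((if i ∈ A then sgn (x i) else 1) * (if i ∈ B then sgn (x i) else 1)) := fun x => by
    rw [Finset.prod_mul_distrib]
    simp [chi, Finset.prod_ite_mem]
  simp_rw [h]
  rw [avg_prod fun i b => (if i ∈ A then sgn b else 1) * (if i ∈ B then sgn b else 1)]
  split_ifs with hAB
  · subst hAB
    refine Finset.prod_eq_one fun i _ => ?_
    split_ifs <;> norm_num
  · obtain ⟨i, hi⟩ : ∃ i, ¬(i ∈ A ↔ i ∈ B) := by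
      by_contra! h
      exact hAB (Finset.ext h)
    refine Finset.prod_eq_zero (Finset.mem_univ i) ?_
    by_cases hA : i ∈ A <;> by_cases hB : i ∈ B <;> simp_all

theorem sum_chi_mul_chi (x y : Cube n) :
    ∑ A, chi A x * chi A y = if x = y then 2 ^ n else 0 := by
  have h : ∑ A, chi A x * chi A y = ∏ i, (1 + sgn (x i) * sgn (y i)) := by
    simp_rw [chi, ← Finset.prod_mul_distrib]
    rw [Finset.prod_one_add]
    simp
  rw [h]
  split_ifs with hxy
  · subst hxy
    simp [sgn_mul_self, one_add_one_eq_two]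
  · obtain ⟨i, hi⟩ := Function.ne_iff.1 hxy
    refine Finset.prod_eq_zero (Finset.mem_univ i) ?_
    revert hi
    cases x i <;> cases y i <;> simp

theorem fourier_inversion (g : Cube n → ℝ) (x : Cube n) : g x = ∑ A, fhat g A * chi A x := by
  simp_rw [fhat, avg, div_mul_eq_mul_div, Finset.sum_mul, ← Finset.sum_div]
  rw [Finset.sum_comm]
  have : ∀ y, ∑ A, g y * chi A y * chi A x = g y * if y = x then 2 ^ n else 0 := fun y => by
    rw [← sum_chi_mul_chi, Finset.mul_sum]
    simp_rw [mul_assoc]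
  simp [this]

theorem fhat_empty (g : Cube n → ℝ) : fhat g ∅ = avg g := by
  simp [fhat, chi_empty]

theorem fhat_add (g h : Cube n → ℝ) (A : Finset (Fin n)) :
    fhat (fun x => g x + h x) A = fhat g A + fhat h A := by
  simp only [fhat, add_mul, avg_add]

theorem fhat_const_mul (c : ℝ) (g : Cube n → ℝ) (A : Finset (Fin n)) :
    fhat (fun x => c * g x) A = c * fhat g A := by
  simp only [fhat, mul_assoc, avg_const_mul]

theorem fhat_sum {ι : Type*} (s : Finset ι) (g : ι → Cube n → ℝ) (A : Finset (Fin n)) :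
    fhat (fun x => ∑ i ∈ s, g i x) A = ∑ i ∈ s, fhat (g i) A := by
  simp only [fhat, Finset.sum_mul, avg_sum]

theorem chi_comp {m : ℕ} (e : Fin m ↪ Fin n) (A : Finset (Fin m)) (x : Cube n) :
    chi A (x ∘ e) = chi (A.map e) x := by
  simp [chi]

theorem avg_mul_comp_comp {m : ℕ} (e e' : Fin m ↪ Fin n) (g h : Cube m → ℝ) :
    avg (fun x : Cube n => g (x ∘ e) * h (x ∘ e')) =
      ∑ A, ∑ B, if A.map e = B.map e' then fhat g A * fhat h B else 0 := by
  have : ∀ x : Cube n, g (x ∘ e) * h (x ∘ e') =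
      ∑ A, ∑ B, (fhat g A * fhat h B) * (chi (A.map e) x * chi (B.map e') x) := fun x => by
    rw [fourier_inversion g, fourier_inversion h, Finset.sum_mul_sum]
    simp_rw [chi_comp]
    refine Finset.sum_congr rfl fun A _ => Finset.sum_congr rfl fun B _ => by ring
  simp_rw [this, avg_sum, avg_const_mul, avg_chi_mul_chi]
  simp

theorem avg_comp {m : ℕ} (e : Fin m ↪ Fin n) (g : Cube m → ℝ) :
    avg (fun x : Cube n => g (x ∘ e)) = avg g := by
  have : ∀ x : Cube n, g (x ∘ e) = ∑ A, fhat g A * (chi (A.map e) x * chi ∅ x) := fun x => by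
    rw [fourier_inversion g]
    simp_rw [chi_comp, chi_empty, mul_one]
  simp_rw [this, avg_sum, avg_const_mul, avg_chi_mul_chi]
  simp [fhat_empty]

theorem parseval (g : Cube n → ℝ) : avg (fun x => g x ^ 2) = ∑ A, fhat g A ^ 2 := by
  simp_rw [pow_two]
  exact (avg_mul_comp_comp (.refl (Fin n)) (.refl (Fin n)) g g).trans (by simp)

theorem exists_perm_map_eq {A B : Finset (Fin n)} (h : A.card = B.card) :
    ∃ σ : Equiv.Perm (Fin n), A.map σ.toEmbedding = B := by
  let e : {x // x ∈ A} ≃ {x // x ∈ B} := Fintype.equivOfCardEq (by simpa using h)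
  refine ⟨e.extendSubtype, Finset.eq_of_subset_of_card_le (fun y hy => ?_) (by simp [h])⟩
  obtain ⟨x, hx, rfl⟩ := Finset.mem_map.1 hy
  simp only [Equiv.coe_toEmbedding]
  rw [e.extendSubtype_apply_of_mem x hx]
  exact (e ⟨x, hx⟩).2

/-- The Fourier coefficients of a symmetric function depend on the size of the set only. -/
theorem fhat_eq_of_card_eq {g : Cube n → ℝ} (hg : ∀ (σ : Equiv.Perm (Fin n)) x, g (x ∘ σ) = g x)
    {A B : Finset (Fin n)} (h : A.card = B.card) : fhat g A = fhat g B := by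
  obtain ⟨σ, rfl⟩ := exists_perm_map_eq h
  rw [fhat, ← avg_comp_perm σ, fhat]
  congr 1
  ext x
  rw [hg, ← chi_comp]
  rfl

end characters

/-! ### Total variation distance -/

section tv

variable {M : ℕ}

theorem toMeasure_real_eq_sum (P : PMF (Cube M)) (s : Set (Cube M)) [DecidablePred (· ∈ s)] :
    P.toMeasure.real s = ∑ x, if x ∈ s then (P x).toReal else 0 := by
  rw [MeasureTheory.measureReal_def, PMF.toMeasure_apply_fintype,
    ENNReal.toReal_sum]
  · refine Finset.sum_congr rfl fun x _ => ?_
    by_cases h : x ∈ s <;> simp [h]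
  · intro x _
    by_cases h : x ∈ s <;> simp [h, P.apply_ne_top]

theorem abs_toMeasure_sub_le (P Q : PMF (Cube M)) (s : Set (Cube M)) :
    |P.toMeasure.real s - Q.toMeasure.real s| ≤ ∑ x, |(P x).toReal - (Q x).toReal| := by
  classical
  rw [toMeasure_real_eq_sum, toMeasure_real_eq_sum, ← Finset.sum_sub_distrib]
  refine (Finset.abs_sum_le_sum_abs _ _).trans (Finset.sum_le_sum fun x _ => ?_)
  split_ifs <;> simp

theorem tvDist_le_sum (P Q : PMF (Cube M)) :
    tvDist P Q ≤ ∑ x, |(P x).toReal - (Q x).toReal| :=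
  ciSup_le fun s => abs_toMeasure_sub_le P Q s

theorem abs_toMeasure_sub_le_tvDist (P Q : PMF (Cube M)) (s : Set (Cube M)) :
    |P.toMeasure.real s - Q.toMeasure.real s| ≤ tvDist P Q :=
  le_ciSup (f := fun s : Set (Cube M) => |P.toMeasure.real s - Q.toMeasure.real s|)
    ⟨_, by rintro _ ⟨s, rfl⟩; exact abs_toMeasure_sub_le P Q s⟩ s

theorem abs_expect_sub_le (P Q : PMF (Cube M)) (φ : Cube M → ℝ) (hφ : ∀ x, |φ x| ≤ 1) :
    |expect P φ - expect Q φ| ≤ 2 * tvDist P Q := by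
  classical
  have h₁ : |expect P φ - expect Q φ| ≤ ∑ x, |(P x).toReal - (Q x).toReal| := by
    rw [expect, expect, ← Finset.sum_sub_distrib]
    refine (Finset.abs_sum_le_sum_abs _ _).trans (Finset.sum_le_sum fun x _ => ?_)
    rw [← sub_mul, abs_mul]
    exact mul_le_of_le_one_right (abs_nonneg _) (hφ x)
  let s : Set (Cube M) := {x | (Q x).toReal ≤ (P x).toReal}
  have h₂ : ∑ x, |(P x).toReal - (Q x).toReal| =
      (P.toMeasure.real s - Q.toMeasure.real s) +
        (Q.toMeasure.real sᶜ - P.toMeasure.real sᶜ) := by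
    rw [toMeasure_real_eq_sum, toMeasure_real_eq_sum, toMeasure_real_eq_sum,
      toMeasure_real_eq_sum, ← Finset.sum_sub_distrib, ← Finset.sum_sub_distrib,
      ← Finset.sum_add_distrib]
    refine Finset.sum_congr rfl fun x _ => ?_
    by_cases h : (Q x).toReal ≤ (P x).toReal
    · simp [s, h]
    · simp only [Set.mem_ofPred_eq, s, h, Set.mem_compl_iff, not_false_eq_true, if_true, if_false]
      rw [abs_of_neg (by linarith)]
      ring
  have h₃ := abs_le.1 (abs_toMeasure_sub_le_tvDist P Q s)
  have h₄ := abs_le.1 (abs_toMeasure_sub_le_tvDist P Q sᶜ)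
  linarith [h₃.2, h₄.1]

end tv

/-! ### The adversarial oracle -/

section oracle

variable {M : ℕ}

open Classical in
/-- The `STAT` oracle for `P` that gives the answer for `D` whenever the tolerance permits it. -/
noncomputable def simOracle (D P : PMF (Cube M)) (q : StatQuery M) : ℝ :=
  if |expect D q.f - expect P q.f| ≤ q.tol then expect D q.f else expect P q.f

theorem isStatOracle_simOracle (D P : PMF (Cube M)) : IsStatOracle P (simOracle D P) := by
  intro q
  unfold simOracle
  split_ifs with h
  · exact h
  · simpa using q.tol_pos.le

variable {F : Type*} [Fintype F]

/-- If every query of tolerance at least `θ` tells at most `B` of the distributions `P f` from `D`,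
then a run of `n` queries of this tolerance has the same output for all but `n * B` of them. -/
theorem card_output_ne_le [DecidableEq F] (P : F → PMF (Cube M)) (D : PMF (Cube M)) {θ B : ℝ}
    (hB : ∀ q : StatQuery M, θ ≤ q.tol →
      ((Finset.univ.filter fun f => ¬|expect D q.f - expect (P f) q.f| ≤ q.tol).card : ℝ) ≤ B)
    (hB0 : 0 ≤ B) (A : SQAlg M) : ∀ (n : ℕ) (G : Finset F),
      (∀ f ∈ G, (∀ q ∈ A.queries (simOracle D (P f)), θ ≤ q.tol) ∧
        (A.queries (simOracle D (P f))).length ≤ n) →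
      ∃ Q : PMF (Cube M), ∃ H ⊆ G, (∀ f ∈ H, A.output (simOracle D (P f)) = Q) ∧
        (G.card : ℝ) ≤ H.card + n * B := by
  induction A with
  | halt Q =>
    intro n G _
    exact ⟨Q, G, subset_rfl, fun f _ => rfl, by nlinarith [(Nat.cast_nonneg n : (0 : ℝ) ≤ n)]⟩
  | ask q next ih =>
    intro n G hG
    rcases G.eq_empty_or_nonempty with rfl | ⟨f₀, hf₀⟩
    · exact ⟨D, ∅, subset_rfl, by simp, by
        have : 0 ≤ (n : ℝ) * B := by positivity
        simpa using this⟩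
    have hq : θ ≤ q.tol := (hG f₀ hf₀).1 q (by simp [SQAlg.queries])
    obtain ⟨n, rfl⟩ : ∃ n', n = n' + 1 := by
      have := (hG f₀ hf₀).2
      simp only [SQAlg.queries, List.length_cons] at this
      exact ⟨n - 1, by omega⟩
    let good : F → Prop := fun f => |expect D q.f - expect (P f) q.f| ≤ q.tol
    classical
    have hans : ∀ f, good f → simOracle D (P f) q = expect D q.f := fun f hf => if_pos hf
    obtain ⟨Q, H, hHG, hQ, hcard⟩ := ih (expect D q.f) n (G.filter good) fun f hf => by
      obtain ⟨hfG, hf⟩ := Finset.mem_filter.1 hf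
      have := hG f hfG
      simp only [SQAlg.queries, hans f hf, List.length_cons, List.mem_cons] at this
      exact ⟨fun q' hq' => this.1 q' (Or.inr hq'), by omega⟩
    refine ⟨Q, H, hHG.trans (Finset.filter_subset _ _), fun f hf => ?_, ?_⟩
    · have := (Finset.mem_filter.1 (hHG hf)).2
      rw [SQAlg.output, hans f this, hQ f hf]
    · have h₁ := Finset.card_filter_add_card_filter_not (s := G) good
      have h₂ : ((G.filter fun f => ¬good f).card : ℝ) ≤ B := by
        refine le_trans ?_ (hB q hq)
        exact_mod_cast Finset.card_le_card fun f hf => by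
          simpa [good] using (Finset.mem_filter.1 hf).2
      have h₃ : ((G.filter good).card : ℝ) + (G.filter fun f => ¬good f).card = G.card := by
        exact_mod_cast h₁
      push_cast
      linarith

open MeasureTheory in
/-- Statistical query lower bound for a finite family of distributions that are hard to tell from
`D` and that are, for the most part, far from each other. -/
theorem exists_oracle_of_family [Nonempty F] (P : F → PMF (Cube M)) (D : PMF (Cube M))
    {θ B err K : ℝ} (hB0 : 0 ≤ B)
    (hB : ∀ q : StatQuery M, θ ≤ q.tol →
      ((Finset.univ.filter fun f => ¬|expect D q.f - expect (P f) q.f| ≤ q.tol).card : ℝ) ≤ B)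
    (hK : K * B ≤ Fintype.card F / 6)
    (hfar : ∀ f, ∃ C : Finset F, (C.card : ℝ) ≤ Fintype.card F / 6 ∧ ∀ g ∉ C,
      ∃ φ : Cube M → ℝ, (∀ x, |φ x| ≤ 1) ∧ 4 * err < |expect (P f) φ - expect (P g) φ|)
    {𝒟 : Set (PMF (Cube M))} (h𝒟 : ∀ f, P f ∈ 𝒟)
    {Ω : Type*} [MeasurableSpace Ω] (ν : Measure Ω) [IsProbabilityMeasure ν] (A : Ω → SQAlg M)
    (hA : LearnsWithProb ν A 𝒟 err (2 / 3)) :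
    ∃ P ∈ 𝒟, ∃ O : StatQuery M → ℝ, IsStatOracle P O ∧
      ∃ᵐ ω ∂ν, (∃ q ∈ (A ω).queries O, q.tol < θ) ∨ K ≤ (((A ω).queries O).length : ℝ) := by
  classical
  by_contra hcon
  push Not at hcon
  have hae : ∀ᵐ ω ∂ν, ∀ f, (∀ q ∈ (A ω).queries (simOracle D (P f)), θ ≤ q.tol) ∧
      (((A ω).queries (simOracle D (P f))).length : ℝ) < K :=
    ae_all_iff.2 fun f => by
      have := hcon (P f) (h𝒟 f) _ (isStatOracle_simOracle D (P f))
      simpa only [Filter.not_frequently, not_or, not_exists, not_and, not_lt, not_le] using this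
  choose E hEm hEp hE using fun f => hA (P f) (h𝒟 f) _ (isStatOracle_simOracle D (P f))
  have hN : (0 : ℝ) < Fintype.card F := by exact_mod_cast Fintype.card_pos
  have hint : Integrable (fun ω => ∑ f, (E f).indicator (fun _ => (1 : ℝ)) ω) ν :=
    integrable_finsetSum _ fun f _ => (integrable_const 1).indicator (hEm f)
  obtain ⟨ω, hω, hle⟩ := exists_notMem_null_integral_le hint (ae_iff.1 hae)
  rw [integral_finsetSum _ fun f _ => (integrable_const 1).indicator (hEm f)] at hle
  simp only [Set.mem_ofPred_eq, not_not] at hω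
  have hsum : Fintype.card F * (2 / 3 : ℝ) ≤
      ∑ f, ∫ a, (E f).indicator (fun _ => (1 : ℝ)) a ∂ν := by
    rw [← nsmul_eq_mul, ← Finset.card_univ, ← Finset.sum_const]
    refine Finset.sum_le_sum fun f _ => ?_
    rw [integral_indicator_const _ (hEm f)]
    simpa using hEp f
  set G : Finset F := Finset.univ.filter fun f => ω ∈ E f with hGdef
  have hG : Fintype.card F * (2 / 3 : ℝ) ≤ G.card := by
    refine (hsum.trans hle).trans (le_of_eq ?_)
    simp [Set.indicator_apply, hGdef]
  obtain ⟨n, hnK, hn⟩ : ∃ n : ℕ, (n : ℝ) ≤ K ∧ ∀ f,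
      ((A ω).queries (simOracle D (P f))).length ≤ n := by
    obtain ⟨f₀⟩ := ‹Nonempty F›
    have : 0 ≤ K := (Nat.cast_nonneg _).trans (hω f₀).2.le
    exact ⟨⌊K⌋₊, Nat.floor_le this, fun f => Nat.le_floor (hω f).2.le⟩
  obtain ⟨Q, H, hHG, hQ, hcard⟩ := card_output_ne_le P D hB hB0 (A ω) n G
    fun f _ => ⟨(hω f).1, hn f⟩
  have hnB : (n : ℝ) * B ≤ Fintype.card F / 6 := (by gcongr : (n : ℝ) * B ≤ K * B).trans hK
  have hH : (Fintype.card F : ℝ) / 2 ≤ H.card := by linarith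
  obtain ⟨f, hf⟩ : H.Nonempty := by
    rw [← Finset.card_pos]
    exact_mod_cast (by linarith : (0 : ℝ) < H.card)
  have hclose : ∀ g ∈ H, tvDist Q (P g) ≤ err := fun g hg => by
    rw [← hQ g hg]
    exact hE g ω (Finset.mem_filter.1 (hHG hg)).2
  have : (H.card : ℝ) ≤ Fintype.card F / 6 := by
    obtain ⟨C, hC, hfar⟩ := hfar f
    refine le_trans (Nat.cast_le.2 (Finset.card_le_card fun g hg => ?_)) hC
    by_contra hgC
    obtain ⟨φ, hφ, hlt⟩ := hfar g hgC
    refine hlt.not_ge ?_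
    have h₁ := abs_le.1 (abs_expect_sub_le Q (P f) φ hφ)
    have h₂ := abs_le.1 (abs_expect_sub_le Q (P g) φ hφ)
    have h₃ := hclose f hf
    have h₄ := hclose g hg
    exact abs_le.2 ⟨by linarith [h₁.2, h₂.1], by linarith [h₁.1, h₂.2]⟩
  linarith

end oracle

/-! ### Distributions given by densities -/

section density

variable {M : ℕ}

theorem sum_ofReal_density (g : Cube M → ℝ) (h0 : ∀ x, 0 ≤ g x) (h1 : avg g = 1) :
    ∑ x, ENNReal.ofReal (g x / 2 ^ M) = 1 := by
  rw [← ENNReal.ofReal_sum_of_nonneg fun x _ => div_nonneg (h0 x) (by positivity),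
    ← Finset.sum_div]
  exact (congrArg ENNReal.ofReal h1).trans ENNReal.ofReal_one

/-- The distribution on the cube with density `g` with respect to the uniform one. -/
noncomputable def densityPMF (g : Cube M → ℝ) (h0 : ∀ x, 0 ≤ g x) (h1 : avg g = 1) :
    PMF (Cube M) :=
  PMF.ofFintype (fun x => ENNReal.ofReal (g x / 2 ^ M)) (sum_ofReal_density g h0 h1)

theorem densityPMF_apply (g : Cube M → ℝ) (h0 : ∀ x, 0 ≤ g x) (h1 : avg g = 1) (x : Cube M) :
    (densityPMF g h0 h1 x).toReal = g x / 2 ^ M := by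
  rw [densityPMF, PMF.ofFintype_apply,
    ENNReal.toReal_ofReal (div_nonneg (h0 x) (by positivity))]

theorem expect_densityPMF (g : Cube M → ℝ) (h0 : ∀ x, 0 ≤ g x) (h1 : avg g = 1)
    (φ : Cube M → ℝ) : expect (densityPMF g h0 h1) φ = avg fun x => g x * φ x := by
  simp only [expect, densityPMF_apply, avg, Finset.sum_div]
  exact Finset.sum_congr rfl fun x _ => by ring

theorem tvDist_densityPMF_le (g : Cube M → ℝ) (h0 : ∀ x, 0 ≤ g x) (h1 : avg g = 1)
    (Q : PMF (Cube M)) (u : Cube M → ℝ) (hQ : ∀ x, (Q x).toReal = u x / 2 ^ M) :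
    tvDist (densityPMF g h0 h1) Q ≤ avg fun x => |g x - u x| := by
  refine (tvDist_le_sum _ _).trans (le_of_eq ?_)
  rw [avg, Finset.sum_div]
  refine Finset.sum_congr rfl fun x _ => ?_
  rw [densityPMF_apply, hQ, ← sub_div, abs_div, abs_of_pos (by positivity : (0 : ℝ) < 2 ^ M)]

end density

/-! ### Product densities with equal biases -/

section tilt

variable {m : ℕ}

/-- The normalized sum of the signs of the coordinates. -/
noncomputable def nsum (y : Cube m) : ℝ := (∑ i, sgn (y i)) / √(m : ℝ)

/-- The density of the product distribution whose coordinates all have mean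
`1 / 2 + x / (2 * √m)`. -/
noncomputable def tilt (x : ℝ) (y : Cube m) : ℝ := ∏ i, (1 + x / √(m : ℝ) * sgn (y i))

theorem abs_mul_sgn (t : ℝ) (b : Bool) : |t * sgn b| = |t| := by
  rw [abs_mul, abs_sgn, mul_one]

theorem tilt_nonneg {x : ℝ} (hx : |x / √(m : ℝ)| ≤ 1) (y : Cube m) : 0 ≤ tilt x y :=
  Finset.prod_nonneg fun i _ => by
    have := (abs_le.1 ((abs_mul_sgn (x / √(m : ℝ)) (y i)).trans_le hx)).1
    linarith

theorem fhat_tilt (x : ℝ) (A : Finset (Fin m)) :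
    fhat (tilt x) A = (x / √(m : ℝ)) ^ A.card := by
  have h : ∀ y : Cube m, tilt x y * chi A y =
      ∏ i, ((1 + x / √(m : ℝ) * sgn (y i)) * if i ∈ A then sgn (y i) else 1) := fun y => by
    rw [Finset.prod_mul_distrib, tilt]
    simp [chi, Finset.prod_ite_mem]
  rw [fhat]
  simp_rw [h]
  rw [avg_prod fun i b => (1 + x / √(m : ℝ) * sgn b) * if i ∈ A then sgn b else 1,
    ← Finset.prod_const, ← Finset.prod_subset (Finset.subset_univ A)]
  · refine Finset.prod_congr rfl fun i hi => ?_
    simp only [hi, if_true, sgn_true, sgn_false]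
    ring
  · intro i _ hi
    simp only [hi, if_false, sgn_true, sgn_false]
    ring

theorem avg_tilt (x : ℝ) : avg (tilt (m := m) x) = 1 := by
  rw [← fhat_empty, fhat_tilt]
  simp

theorem avg_tilt_sq (hm : 0 < m) (x : ℝ) : avg (fun y : Cube m => tilt x y ^ 2) ≤ Real.exp (x ^ 2) := by
  have h : ∀ y : Cube m, tilt x y ^ 2 = ∏ i, (1 + x / √(m : ℝ) * sgn (y i)) ^ 2 := fun y => by
    rw [tilt, Finset.prod_pow]
  simp_rw [h]
  rw [avg_prod fun i b => (1 + x / √(m : ℝ) * sgn b) ^ 2]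
  have hm' : (0 : ℝ) < m := by exact_mod_cast hm
  have : ((1 + x / √(m : ℝ) * sgn true) ^ 2 + (1 + x / √(m : ℝ) * sgn false) ^ 2) / 2 =
      x ^ 2 / m + 1 := by
    simp only [sgn_true, sgn_false]
    rw [show x ^ 2 / m = (x / √(m : ℝ)) ^ 2 by rw [div_pow, Real.sq_sqrt hm'.le]]
    ring
  rw [this, Finset.prod_const, Finset.card_univ, Fintype.card_fin]
  calc (x ^ 2 / m + 1) ^ m ≤ Real.exp (x ^ 2 / m) ^ m := by
        gcongr
        exact Real.add_one_le_exp _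
    _ = Real.exp (x ^ 2) := by
        rw [← Real.exp_nat_mul]
        congr 1
        field_simp

theorem tilt_le_exp {x : ℝ} (hx : |x / √(m : ℝ)| ≤ 1) (y : Cube m) :
    tilt x y ≤ Real.exp (x * nsum y) := by
  rw [nsum, mul_div_left_comm, mul_comm, Finset.mul_sum, Real.exp_sum]
  refine Finset.prod_le_prod (fun i _ => ?_) fun i _ => ?_
  · have := (abs_le.1 ((abs_mul_sgn (x / √(m : ℝ)) (y i)).trans_le hx)).1
    linarith
  · linarith [Real.add_one_le_exp (x / √(m : ℝ) * sgn (y i))]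

theorem exp_sub_two_mul_sq_le {z : ℝ} (hz : |z| ≤ 1 / 2) :
    Real.exp (z - 2 * z ^ 2) ≤ 1 + z := by
  have h₁ := (abs_le.1 hz).1
  have hpos : 0 < 1 + z := by linarith
  rw [← Real.le_log_iff_exp_le hpos]
  refine le_trans ?_ (Real.one_sub_inv_le_log_of_pos hpos)
  rw [← sub_nonneg]
  have : 1 - (1 + z)⁻¹ - (z - 2 * z ^ 2) = z ^ 2 * (1 + 2 * z) / (1 + z) := by
    field_simp
    ring
  rw [this]
  have : 0 ≤ 1 + 2 * z := by linarith
  positivity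

theorem exp_le_tilt (hm : 0 < m) {x : ℝ} (hx : |x / √(m : ℝ)| ≤ 1 / 2) (y : Cube m) :
    Real.exp (x * nsum y - 2 * x ^ 2) ≤ tilt x y := by
  have hm' : (0 : ℝ) < m := by exact_mod_cast hm
  have : x * nsum y - 2 * x ^ 2 =
      ∑ i, (x / √(m : ℝ) * sgn (y i) - 2 * (x / √(m : ℝ) * sgn (y i)) ^ 2) := by
    have h2 : ∀ i, (x / √(m : ℝ) * sgn (y i)) ^ 2 = x ^ 2 / m := fun i => by
      rw [mul_pow, pow_two (sgn _), sgn_mul_self, div_pow, Real.sq_sqrt hm'.le, mul_one]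
    simp_rw [h2]
    rw [Finset.sum_sub_distrib, ← Finset.mul_sum, Finset.sum_const, Finset.card_univ,
      Fintype.card_fin, nsmul_eq_mul, nsum]
    field_simp
  rw [this, Real.exp_sum]
  refine Finset.prod_le_prod (fun i _ => (Real.exp_pos _).le) fun i _ => ?_
  exact exp_sub_two_mul_sq_le ((abs_mul_sgn _ _).trans_le hx)

theorem nsum_comp_perm (σ : Equiv.Perm (Fin m)) (y : Cube m) : nsum (y ∘ σ) = nsum y := by
  unfold nsum
  congr 1
  exact Equiv.sum_comp σ fun i => sgn (y i)

theorem tilt_comp_perm (x : ℝ) (σ : Equiv.Perm (Fin m)) (y : Cube m) :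
    tilt x (y ∘ σ) = tilt x y :=
  Equiv.prod_comp σ fun i => 1 + x / √(m : ℝ) * sgn (y i)

theorem shiftedUniform_map_apply {M : ℕ} (e : Fin m ↪ Fin M) {x : ℝ} (hx0 : 0 ≤ x)
    (hx : x / √(m : ℝ) ≤ 1 / 2) (y : Cube M) :
    (shiftedUniform M (Finset.univ.map e) (x / √(m : ℝ)) y).toReal =
      tilt (2 * x) (y ∘ e) / 2 ^ M := by
  set η := x / √(m : ℝ) with hη
  have hη0 : 0 ≤ η := by positivity
  have hS : ∀ i, ((Set.projIcc (0 : ℝ) 1 zero_le_one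
      (if i ∈ Finset.univ.map e then 1 / 2 + η else 1 / 2) : unitInterval) : ℝ) =
      if i ∈ Finset.univ.map e then 1 / 2 + η else 1 / 2 := fun i => by
    rw [Set.projIcc_of_mem]
    split_ifs <;> constructor <;> linarith
  have h2 : ∀ i, (if y i then (if i ∈ Finset.univ.map e then 1 / 2 + η else 1 / 2)
      else 1 - (if i ∈ Finset.univ.map e then 1 / 2 + η else 1 / 2)) =
      (if i ∈ Finset.univ.map e then 1 + 2 * η * sgn (y i) else 1) / 2 := fun i => by
    by_cases hi : i ∈ Finset.univ.map e <;> simp only [hi, if_true, if_false] <;> cases y i <;>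
      simp <;> ring
  rw [shiftedUniform, binaryProduct, PMF.ofFintype_apply, ENNReal.toReal_prod]
  simp_rw [hS, h2]
  have h3 : ∀ i, 0 ≤ (if i ∈ Finset.univ.map e then 1 + 2 * η * sgn (y i) else 1) / 2 :=
    fun i => by
      split_ifs
      · cases y i
        · simp; linarith
        · simp; linarith
      · norm_num
  simp_rw [fun i => ENNReal.toReal_ofReal (h3 i)]
  rw [Finset.prod_div_distrib, Finset.prod_const, Finset.card_univ, Fintype.card_fin,
    Finset.prod_ite_mem, Finset.univ_inter, Finset.prod_map, tilt]
  simp [hη, mul_div_assoc]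

end tilt

/-! ### Families of embedded copies of a density -/

section family

variable {m M : ℕ}

/-- The coordinates on which two embeddings agree. -/
def agree (e e' : Fin m ↪ Fin M) : Finset (Fin m) := Finset.univ.filter fun i => e i = e' i

theorem avg_comp_mul_comp {e e' : Fin m ↪ Fin M} (h : ∀ i j, e i = e' j → i = j)
    (g k : Cube m → ℝ) :
    avg (fun x : Cube M => g (x ∘ e) * k (x ∘ e')) =
      ∑ A ∈ (agree e e').powerset, fhat g A * fhat k A := by
  have key : ∀ A B : Finset (Fin m), A.map e = B.map e' ↔ A = B ∧ A ⊆ agree e e' := by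
    intro A B
    constructor
    · intro hAB
      have h₁ : ∀ i ∈ A, i ∈ B ∧ e i = e' i := fun i hi => by
        have : e i ∈ B.map e' := hAB ▸ Finset.mem_map_of_mem e hi
        obtain ⟨j, hj, hji⟩ := Finset.mem_map.1 this
        obtain rfl := h i j hji.symm
        exact ⟨hj, hji.symm⟩
      have h₂ : ∀ i ∈ B, i ∈ A := fun i hi => by
        have : e' i ∈ A.map e := hAB ▸ Finset.mem_map_of_mem e' hi
        obtain ⟨j, hj, hji⟩ := Finset.mem_map.1 this
        obtain rfl := h j i hji
        exact hj
      exact ⟨Finset.Subset.antisymm (fun i hi => (h₁ i hi).1) h₂,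
        fun i hi => by simpa [agree] using (h₁ i hi).2⟩
    · rintro ⟨rfl, hA⟩
      rw [Finset.map_eq_image, Finset.map_eq_image]
      refine Finset.image_congr fun i hi => ?_
      simpa [agree] using hA hi
  rw [avg_mul_comp_comp]
  simp_rw [key, ite_and]
  simp only [Finset.sum_ite_eq, Finset.mem_univ, if_true]
  rw [← Finset.sum_filter]
  congr 1
  ext A
  simp

theorem avg_sub_one_mul_sub_one {e e' : Fin m ↪ Fin M} (h : ∀ i j, e i = e' j → i = j)
    {g : Cube m → ℝ} (hg : avg g = 1) :
    avg (fun x : Cube M => (g (x ∘ e) - 1) * (g (x ∘ e') - 1)) =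
      ∑ A ∈ (agree e e').powerset.erase ∅, fhat g A ^ 2 := by
  have h₁ := Finset.add_sum_erase (agree e e').powerset (fun A => fhat g A ^ 2)
    (Finset.empty_mem_powerset _)
  have h₂ := avg_comp_mul_comp h g g
  simp_rw [← pow_two] at h₂
  have h₃ : avg (fun x : Cube M => (g (x ∘ e) - 1) * (g (x ∘ e') - 1)) =
      avg (fun x : Cube M => g (x ∘ e) * g (x ∘ e')) - avg (fun x : Cube M => g (x ∘ e)) -
        avg (fun x : Cube M => g (x ∘ e')) + 1 := by
    have := avg_add (fun x : Cube M => g (x ∘ e) * g (x ∘ e') - g (x ∘ e) - g (x ∘ e')) fun _ => 1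
    rw [avg_one, avg_sub, avg_sub] at this
    rw [← this]
    exact congrArg avg (funext fun x => by ring)
  rw [h₃, h₂, avg_comp, avg_comp, hg, ← h₁, fhat_empty, hg]
  ring

variable {F : Type*} [Fintype F] [Nonempty F]

/-- A bounded function distinguishes few members of a family with small pairwise correlations
from the uniform distribution. -/
theorem card_distinguished_le (e : F → Fin m ↪ Fin M)
    (he : ∀ f f' i j, e f i = e f' j → i = j) {g : Cube m → ℝ} (hg : avg g = 1)
    {t : ℕ} {W τ β : ℝ} (hτ : 0 < τ)
    (hβ : ∀ I : Finset (Fin m), ∑ A ∈ I.powerset.erase ∅, fhat g A ^ 2 ≤ β)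
    (hlo : ∀ I : Finset (Fin m), I.card ≤ t → ∑ A ∈ I.powerset.erase ∅, fhat g A ^ 2 ≤ τ)
    (hW : ∀ f, ((Finset.univ.filter fun f' => t < (agree (e f) (e f')).card).card : ℝ) ≤ W)
    {φ : Cube M → ℝ} (hφ : ∀ x, |φ x| ≤ 1) (G : Finset F)
    (hG : ∀ f ∈ G, √(2 * τ) ≤ |avg fun x => (g (x ∘ e f) - 1) * φ x|) :
    (G.card : ℝ) ≤ W * β / τ := by
  classical
  let c : F → F → ℝ := fun f f' => avg fun x => (g (x ∘ e f) - 1) * (g (x ∘ e f') - 1)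
  have hc : ∀ f f', c f f' = ∑ A ∈ (agree (e f) (e f')).powerset.erase ∅, fhat g A ^ 2 :=
    fun f f' => avg_sub_one_mul_sub_one (he f f') hg
  have hβ0 : 0 ≤ β := by simpa using hβ ∅
  obtain ⟨s, hs, hsabs⟩ : ∃ s : F → ℝ, (∀ f, |s f| ≤ 1) ∧ ∀ f,
      s f * (avg fun x => (g (x ∘ e f) - 1) * φ x) =
        |avg fun x => (g (x ∘ e f) - 1) * φ x| := by
    refine ⟨fun f => SignType.sign (avg fun x => (g (x ∘ e f) - 1) * φ x), fun f => ?_,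
      fun f => sign_mul_self _⟩
    rcases lt_trichotomy (avg fun x => (g (x ∘ e f) - 1) * φ x) 0 with h | h | h <;> simp [h]
  have h₁ : G.card * √(2 * τ) ≤ avg fun x => (∑ f ∈ G, s f * (g (x ∘ e f) - 1)) * φ x := by
    simp_rw [Finset.sum_mul, mul_assoc]
    rw [avg_sum]
    simp_rw [avg_const_mul, hsabs]
    rw [← nsmul_eq_mul, ← Finset.sum_const]
    exact Finset.sum_le_sum hG
  have h₂ : avg (fun x => φ x ^ 2) ≤ 1 := by
    rw [← avg_one (n := M)]
    exact avg_mono fun x => by rw [← sq_abs]; exact pow_le_one₀ (abs_nonneg _) (hφ x)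
  have h₃ : avg (fun x => (∑ f ∈ G, s f * (g (x ∘ e f) - 1)) ^ 2) ≤
      G.card * (G.card * τ + W * β) := by
    have h : ∀ x : Cube M, (∑ f ∈ G, s f * (g (x ∘ e f) - 1)) ^ 2 =
        ∑ f ∈ G, ∑ f' ∈ G, (s f * s f') * ((g (x ∘ e f) - 1) * (g (x ∘ e f') - 1)) := fun x => by
      rw [pow_two, Finset.sum_mul_sum]
      exact Finset.sum_congr rfl fun f _ => Finset.sum_congr rfl fun f' _ => by ring
    simp_rw [h, avg_sum, avg_const_mul]
    rw [← nsmul_eq_mul, ← Finset.sum_const]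
    refine Finset.sum_le_sum fun f _ => ?_
    have hle : ∀ f', s f * s f' * c f f' ≤
        τ + if t < (agree (e f) (e f')).card then β else 0 := fun f' => by
      have hc0 : 0 ≤ c f f' := by
        rw [hc]
        exact Finset.sum_nonneg fun A _ => sq_nonneg _
      have hss : s f * s f' ≤ 1 := (le_abs_self _).trans (by
        rw [abs_mul]
        exact mul_le_one₀ (hs f) (abs_nonneg _) (hs f'))
      refine (mul_le_of_le_one_left hc0 hss).trans ?_
      rw [hc]
      split_ifs with hcard
      · exact (hβ _).trans (by linarith)
      · exact (hlo _ (not_lt.1 hcard)).trans (by linarith)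
    refine (Finset.sum_le_sum fun f' _ => hle f').trans ?_
    rw [Finset.sum_add_distrib, Finset.sum_const, nsmul_eq_mul, ← Finset.sum_filter,
      Finset.sum_const, nsmul_eq_mul]
    gcongr
    refine le_trans ?_ (hW f)
    exact_mod_cast Finset.card_le_card (Finset.filter_subset_filter _ (Finset.subset_univ G))
  have h₄ := avg_mul_sq_le (fun x => ∑ f ∈ G, s f * (g (x ∘ e f) - 1)) φ
  have h₅ : (G.card * √(2 * τ)) ^ 2 ≤ G.card * (G.card * τ + W * β) := by
    refine (pow_le_pow_left₀ (by positivity) h₁ 2).trans (h₄.trans ?_)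
    have : 0 ≤ avg (fun x => (∑ f ∈ G, s f * (g (x ∘ e f) - 1)) ^ 2) :=
      avg_nonneg fun x => sq_nonneg _
    nlinarith
  rw [mul_pow, Real.sq_sqrt (by positivity)] at h₅
  rw [le_div_iff₀ hτ]
  rcases G.card.eq_zero_or_pos with h0 | h0
  · obtain ⟨f⟩ := ‹Nonempty F›
    rw [h0]
    simpa using mul_nonneg ((Nat.cast_nonneg _).trans (hW f)) hβ0
  · have h0' : (0 : ℝ) < G.card := by exact_mod_cast h0
    have : (G.card : ℝ) * (G.card * τ) ≤ G.card * (W * β) := by nlinarith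
    exact le_of_mul_le_mul_left this h0'

end family

/-! ### Words that agree in many places -/

theorem card_agree_mul_two_pow_le {m L : ℕ} (f : Fin m → Fin L) (t : ℕ) :
    (Finset.univ.filter fun f' : Fin m → Fin L =>
      t < (Finset.univ.filter fun i => f i = f' i).card).card * 2 ^ t ≤ (L + 1) ^ m := by
  have h₁ : ∑ f' : Fin m → Fin L, 2 ^ (Finset.univ.filter fun i => f i = f' i).card =
      (L + 1) ^ m := by
    have h : ∀ f' : Fin m → Fin L, 2 ^ (Finset.univ.filter fun i => f i = f' i).card =
        ∏ i, (1 + if f i = f' i then 1 else 0) := fun f' => by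
      rw [← Finset.prod_const, Finset.prod_filter]
      exact Finset.prod_congr rfl fun i _ => by split_ifs <;> rfl
    have h' := Finset.prod_univ_sum (fun _ : Fin m => (Finset.univ : Finset (Fin L)))
      fun i b => 1 + if f i = b then 1 else 0
    rw [Fintype.piFinset_univ] at h'
    simp_rw [h]
    rw [← h']
    simp [Finset.sum_add_distrib]
  rw [← h₁, ← smul_eq_mul, ← Finset.sum_const]
  refine (Finset.sum_le_sum fun f' hf' => ?_).trans
    (Finset.sum_le_sum_of_subset (Finset.filter_subset _ _))
  exact Nat.pow_le_pow_right two_pos (Finset.mem_filter.1 hf').2.le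

/-! ### Product distributions with different biased coordinates are far from each other -/

section separation

variable {m M : ℕ}

theorem sin_sum_eq_im (θ : ℝ) (J : Finset (Fin m)) (y : Cube m) :
    Real.sin (θ * ∑ i ∈ J, sgn (y i)) =
      (∏ i, if i ∈ J then Complex.exp ((θ * sgn (y i) : ℝ) * Complex.I) else 1).im := by
  rw [Finset.prod_ite_mem, Finset.univ_inter, ← Complex.exp_sum, ← Finset.sum_mul,
    ← Complex.ofReal_sum, Complex.exp_ofReal_mul_I_im, Finset.mul_sum]

theorem avg_prod_mul_sin (w : Fin m → Bool → ℝ) (θ : ℝ) (J : Finset (Fin m)) :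
    avg (fun y => (∏ i, w i (y i)) * Real.sin (θ * ∑ i ∈ J, sgn (y i))) =
      (∏ i, if i ∈ J then (((w i true + w i false) / 2 * Real.cos θ : ℝ) : ℂ) +
          ((w i true - w i false) / 2 * Real.sin θ : ℝ) * Complex.I
        else (((w i true + w i false) / 2 : ℝ) : ℂ)).im := by
  have h : ∀ y : Cube m, (∏ i, w i (y i)) * Real.sin (θ * ∑ i ∈ J, sgn (y i)) =
      (∏ i, ((w i (y i) : ℂ) * if i ∈ J then
        Complex.exp ((θ * sgn (y i) : ℝ) * Complex.I) else 1)).im := fun y => by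
    rw [Finset.prod_mul_distrib, ← Complex.ofReal_prod, Complex.im_ofReal_mul, sin_sum_eq_im]
  simp_rw [h]
  have h2 := sum_cube_prod (n := m) fun i b => (w i b : ℂ) * if i ∈ J then
        Complex.exp ((θ * sgn b : ℝ) * Complex.I) else 1
  rw [avg, ← Complex.im_sum, h2]
  have h3 : ∀ z : ℂ, z.im / 2 ^ m = (z / 2 ^ m).im := fun z => by
    rw [show (2 : ℂ) ^ m = ((2 ^ m : ℝ) : ℂ) by push_cast; rfl, Complex.div_ofReal_im]
  have h4 : ((2 : ℂ) ^ m) = ∏ _i : Fin m, 2 := by simp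
  rw [h3, h4, ← Finset.prod_div_distrib]
  congr 1
  refine Finset.prod_congr rfl fun i _ => ?_
  split_ifs
  · simp only [sgn_true, sgn_false, mul_one, mul_neg, Complex.exp_mul_I, ← Complex.ofReal_cos,
      ← Complex.ofReal_sin, Real.cos_neg, Real.sin_neg]
    push_cast
    ring
  · push_cast
    ring

theorem im_one_add_mul_I_pow_ge {y : ℝ} (hy : 0 ≤ y) : ∀ n : ℕ, n * y ≤ 1 / 2 →
    ((1 + y * Complex.I) ^ n).re ≤ 1 ∧ 1 - (n * y) ^ 2 ≤ ((1 + y * Complex.I) ^ n).re ∧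
      ((1 + y * Complex.I) ^ n).im ≤ n * y ∧ 3 / 4 * (n * y) ≤ ((1 + y * Complex.I) ^ n).im := by
  intro n
  induction n with
  | zero => simp
  | succ n ih =>
    intro h
    push_cast at h ⊢
    have hn : 0 ≤ (n : ℝ) * y := by positivity
    obtain ⟨h₁, h₂, h₃, h₄⟩ := ih (by linarith)
    rw [pow_succ, Complex.mul_re, Complex.mul_im]
    simp only [Complex.add_re, Complex.one_re, Complex.re_ofReal_mul, Complex.I_re, mul_zero,
      add_zero, mul_one, Complex.add_im, Complex.one_im, Complex.im_ofReal_mul, Complex.I_im,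
      zero_add]
    set a := ((1 + y * Complex.I) ^ n).re
    set b := ((1 + y * Complex.I) ^ n).im
    have hb : 0 ≤ b := by linarith
    have ha : 3 / 4 ≤ a := by nlinarith
    refine ⟨by nlinarith, ?_, by nlinarith, by nlinarith⟩
    have : b * y ≤ n * y * y := by gcongr
    nlinarith

theorem avg_tilt_mul_sin_ge (hm : 0 < m) {δ : ℝ} (hδ0 : 0 ≤ δ) (hδ : δ ≤ 1 / 8)
    (J : Finset (Fin m)) (hJ : (m : ℝ) / 2 ≤ J.card) :
    3 / 8 * δ ≤ avg fun y : Cube m =>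
      tilt (2 * δ) y * Real.sin (1 / √(m : ℝ) * ∑ i ∈ J, sgn (y i)) := by
  unfold tilt
  rw [avg_prod_mul_sin fun _ b => 1 + 2 * δ / √(m : ℝ) * sgn b]
  have hm1 : (1 : ℝ) ≤ m := by exact_mod_cast hm
  have hs1 : 1 ≤ √(m : ℝ) := Real.one_le_sqrt.2 hm1
  have hs0 : 0 < √(m : ℝ) := by positivity
  set θ : ℝ := 1 / √(m : ℝ) with hθ
  have hθ0 : 0 < θ := by positivity
  have hθ1 : θ ≤ 1 := by rw [hθ, div_le_one hs0]; exact hs1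
  have hθ2 : θ ^ 2 = 1 / m := by rw [hθ, div_pow, Real.sq_sqrt (by positivity), one_pow]
  have hπ := Real.pi_gt_three
  have hcos : 1 - θ ^ 2 / 2 ≤ Real.cos θ := Real.one_sub_sq_div_two_le_cos
  have hcos2 : 1 / 2 ≤ Real.cos θ := by nlinarith
  have hd : (J.card : ℝ) ≤ m := by
    exact_mod_cast (Finset.card_le_univ J).trans_eq (Fintype.card_fin m)
  set y : ℝ := 2 * δ * θ * Real.tan θ with hy
  have htan : θ ≤ Real.tan θ := Real.le_tan hθ0.le (by linarith)
  have htan2 : Real.tan θ ≤ 2 * θ := by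
    rw [Real.tan_eq_sin_div_cos, div_le_iff₀ (by linarith)]
    have := Real.sin_le hθ0.le
    nlinarith
  have hy0 : 0 ≤ y := by
    have : 0 ≤ Real.tan θ := hθ0.le.trans htan
    positivity
  have hy1 : 2 * δ * (1 / m) ≤ y := by
    rw [← hθ2, hy, pow_two, ← mul_assoc]
    gcongr
  have hy2 : y ≤ 4 * δ * (1 / m) := by
    rw [← hθ2, hy]
    calc 2 * δ * θ * Real.tan θ ≤ 2 * δ * θ * (2 * θ) := by gcongr
      _ = 4 * δ * θ ^ 2 := by ring
  have hfac : ∀ i, (if i ∈ J then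
      ((((1 + 2 * δ / √(m : ℝ) * sgn true) + (1 + 2 * δ / √(m : ℝ) * sgn false)) / 2 *
        Real.cos θ : ℝ) : ℂ) +
      (((1 + 2 * δ / √(m : ℝ) * sgn true) - (1 + 2 * δ / √(m : ℝ) * sgn false)) / 2 *
        Real.sin θ : ℝ) * Complex.I
      else ((((1 + 2 * δ / √(m : ℝ) * sgn true) +
        (1 + 2 * δ / √(m : ℝ) * sgn false)) / 2 : ℝ) : ℂ)) =
      if i ∈ J then ((Real.cos θ : ℝ) : ℂ) * (1 + y * Complex.I) else 1 := fun i => by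
    simp only [sgn_true, sgn_false]
    split_ifs
    · have h1 : ((1 + 2 * δ / √(m : ℝ) * 1) + (1 + 2 * δ / √(m : ℝ) * -1)) / 2 * Real.cos θ =
          Real.cos θ := by ring
      have h2 : ((1 + 2 * δ / √(m : ℝ) * 1) - (1 + 2 * δ / √(m : ℝ) * -1)) / 2 * Real.sin θ =
          Real.cos θ * y := by
        have hc0 : Real.cos θ ≠ 0 := by linarith
        rw [hy, mul_left_comm, mul_comm (Real.cos θ), Real.tan_mul_cos hc0,
          show 2 * δ / √(m : ℝ) = 2 * δ * θ by rw [hθ]; ring]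
        ring
      rw [h1, h2]
      push_cast
      ring
    · have h1 : ((1 + 2 * δ / √(m : ℝ) * 1) + (1 + 2 * δ / √(m : ℝ) * -1)) / 2 = 1 := by ring
      rw [h1, Complex.ofReal_one]
  simp_rw [hfac]
  rw [Finset.prod_ite_mem, Finset.univ_inter, Finset.prod_const, mul_pow, ← Complex.ofReal_pow,
    Complex.im_ofReal_mul]
  have hm0 : (0 : ℝ) < m := by linarith
  have hdy : J.card * y ≤ 1 / 2 := by
    calc J.card * y ≤ m * (4 * δ * (1 / m)) := by gcongr
      _ = 4 * δ := by field_simp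
      _ ≤ 1 / 2 := by linarith
  have hdy2 : δ ≤ J.card * y := by
    calc δ = m / 2 * (2 * δ * (1 / m)) := by field_simp
      _ ≤ J.card * y := by gcongr
  have him := (im_one_add_mul_I_pow_ge hy0 J.card hdy).2.2.2
  have hc : 1 / 2 ≤ Real.cos θ ^ J.card := by
    have h := one_add_mul_le_pow (a := Real.cos θ - 1) (by linarith) J.card
    rw [add_sub_cancel] at h
    refine le_trans ?_ h
    have : (J.card : ℝ) * (1 - Real.cos θ) ≤ m * (1 / m / 2) := by
      have : 1 - Real.cos θ ≤ 1 / m / 2 := by rw [← hθ2]; linarith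
      have h0 : 0 ≤ 1 - Real.cos θ := by linarith [Real.cos_le_one θ]
      gcongr
    have h2 : (m : ℝ) * (1 / m / 2) = 1 / 2 := by field_simp
    linarith
  nlinarith

theorem fhat_sin_eq_zero (θ : ℝ) {A J : Finset (Fin m)} (h : Disjoint A J) :
    fhat (fun y => Real.sin (θ * ∑ i ∈ J, sgn (y i))) A = 0 := by
  have h1 : ∀ y : Cube m, Real.sin (θ * ∑ i ∈ J, sgn (y i)) * chi A y =
      (∏ i, if i ∈ A then sgn (y i) else 1) * Real.sin (θ * ∑ i ∈ J, sgn (y i)) := fun y => by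
    rw [mul_comm, chi, Finset.prod_ite_mem, Finset.univ_inter]
  rw [fhat]
  simp_rw [h1]
  rw [avg_prod_mul_sin fun i b => if i ∈ A then sgn b else 1]
  have h2 : ∀ i, (if i ∈ J then
      ((((if i ∈ A then sgn true else 1) + (if i ∈ A then sgn false else 1)) / 2 *
        Real.cos θ : ℝ) : ℂ) +
      (((if i ∈ A then sgn true else 1) - (if i ∈ A then sgn false else 1)) / 2 *
        Real.sin θ : ℝ) * Complex.I
      else ((((if i ∈ A then sgn true else 1) +
        (if i ∈ A then sgn false else 1)) / 2 : ℝ) : ℂ)) =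
      ((if i ∈ J then Real.cos θ else if i ∈ A then 0 else 1 : ℝ) : ℂ) := fun i => by
    by_cases hJ : i ∈ J
    · have hA : i ∉ A := fun hA => Finset.disjoint_left.1 h hA hJ
      simp [hA, hJ]
    · by_cases hA : i ∈ A <;> simp [hA, hJ]
  simp_rw [h2]
  rw [← Complex.ofReal_prod, Complex.ofReal_im]

/-- Two product distributions with biases `δ / √m` on sets of size `m` that have at most `m / 2`
coordinates in common are at distance at least a constant times `δ`. -/
theorem exists_test_of_agree_le (hm : 0 < m) {δ : ℝ} (hδ0 : 0 ≤ δ) (hδ : δ ≤ 1 / 8)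
    {e e' : Fin m ↪ Fin M} (h : ∀ i j, e i = e' j → i = j)
    (hcard : ((agree e e').card : ℝ) ≤ m / 2) :
    ∃ φ : Cube M → ℝ, (∀ x, |φ x| ≤ 1) ∧
      3 / 8 * δ ≤ avg (fun x => tilt (2 * δ) (x ∘ e) * φ x) -
        avg (fun x => tilt (2 * δ) (x ∘ e') * φ x) := by
  let J := (agree e e')ᶜ
  let ψ : Cube m → ℝ := fun y => Real.sin (1 / √(m : ℝ) * ∑ i ∈ J, sgn (y i))
  have hJ : (m : ℝ) / 2 ≤ J.card := by
    have := Finset.card_add_card_compl (agree e e')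
    rw [Fintype.card_fin] at this
    have h' : ((agree e e').card : ℝ) + J.card = m := by exact_mod_cast this
    linarith
  refine ⟨fun x => ψ (x ∘ e), fun x => Real.abs_sin_le_one _, ?_⟩
  have h₁ := avg_comp e fun y => tilt (2 * δ) y * ψ y
  have h₂ := avg_comp_mul_comp h ψ (tilt (2 * δ))
  rw [Finset.sum_eq_zero fun A hA => by
    rw [fhat_sin_eq_zero, zero_mul]
    exact Finset.disjoint_left.2 fun i hi hJ =>
      (Finset.mem_compl.1 hJ) (Finset.mem_powerset.1 hA hi)] at h₂
  simp_rw [mul_comm (tilt (2 * δ) (_ ∘ e'))]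
  rw [h₁, h₂, sub_zero]
  exact avg_tilt_mul_sin_ge hm hδ0 hδ J hJ

end separation

/-! ### Chebyshev quadrature -/

section chebyshev

open Polynomial Polynomial.Chebyshev

theorem avg_nodes_T_mul_T {N : ℕ} (hN : N ≠ 0) {j n : ℕ} (hj : j < N) (hn : n < N) :
    1 / (N : ℝ) * ∑ i ∈ Finset.range N,
      (T ℝ j).eval (Real.cos ((2 * i + 1) / (2 * N) * Real.pi)) *
        (T ℝ n).eval (Real.cos ((2 * i + 1) / (2 * N) * Real.pi)) =
      if j = n then (if n = 0 then 1 else 1 / 2) else 0 := by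
  have hπ := Real.pi_ne_zero
  have hN' : (N : ℝ) ≠ 0 := by exact_mod_cast hN
  have key : ∀ k : ℤ, 1 / (N : ℝ) * ∑ i ∈ Finset.range N,
      (T ℝ k).eval (Real.cos ((2 * i + 1) / (2 * N) * Real.pi)) =
        sumZeroes N (T ℝ k) / Real.pi := fun k => by
    rw [sumZeroes, mul_div_right_comm, div_right_comm, div_self hπ]
  have hmul : ∀ x : ℝ, (T ℝ j).eval x * (T ℝ n).eval x =
      1 / 2 * ((T ℝ (j + n : ℤ)).eval x + (T ℝ (j - n : ℤ)).eval x) := fun x => by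
    have := congrArg (Polynomial.eval x) (T_mul_T ℝ j n)
    simp only [eval_mul, eval_add, eval_ofNat] at this
    linarith
  simp_rw [hmul]
  rw [← Finset.mul_sum, Finset.sum_add_distrib, mul_left_comm, mul_add, key, key]
  have hz : sumZeroes N (T ℝ 0) / Real.pi = 1 := by
    rw [sumZeroes_T_zero hN, div_self hπ]
  have hnz : ∀ k : ℤ, k ≠ 0 → |k| < 2 * N → sumZeroes N (T ℝ k) / Real.pi = 0 :=
    fun k hk hkN => by
      rw [sumZeroes_T_of_not_dvd, zero_div]
      exact fun hdvd => hk (Int.eq_zero_of_abs_lt_dvd hdvd hkN)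
  split_ifs with h1 h2
  · subst h1 h2
    simp only [Nat.cast_zero, add_zero, sub_zero, hz]
    norm_num
  · subst h1
    rw [sub_self, hz, hnz _ (by omega) (by rw [abs_lt]; omega)]
    norm_num
  · rw [hnz _ (by omega) (by rw [abs_lt]; omega), hnz _ (by omega) (by rw [abs_lt]; omega)]
    norm_num

/-- Every linear functional on polynomials of degree at most `K` is a signed average over the
Chebyshev nodes, with weights bounded by the values of the functional at the Chebyshev
polynomials. -/
theorem exists_chebyshev_nodes (K : ℕ) :
    ∃ y : ℕ → ℝ, (∀ l, |y l| ≤ 1) ∧ ∀ Λ : ℝ[X] →ₗ[ℝ] ℝ, ∃ r : ℕ → ℝ,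
      (∀ l, |r l| ≤ 2 * ∑ n ∈ Finset.range (K + 1), |Λ (T ℝ n)|) ∧
      ∀ j ≤ K, 1 / ((K + 1 : ℕ) : ℝ) * ∑ l ∈ Finset.range (K + 1), r l * y l ^ j = Λ (X ^ j) := by
  let N := K + 1
  let y : ℕ → ℝ := fun i => Real.cos ((2 * i + 1) / (2 * N) * Real.pi)
  have hy : ∀ l, |y l| ≤ 1 := fun l => Real.abs_cos_le_one _
  refine ⟨y, hy, fun Λ => ?_⟩
  let r : ℕ → ℝ := fun l => ∑ n ∈ Finset.range N,
    (if n = 0 then 1 else 2) * Λ (T ℝ n) * (T ℝ n).eval (y l)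
  refine ⟨r, fun l => ?_, ?_⟩
  · rw [Finset.mul_sum]
    refine (Finset.abs_sum_le_sum_abs _ _).trans (Finset.sum_le_sum fun n _ => ?_)
    rw [abs_mul, abs_mul]
    have h1 : |(if n = 0 then 1 else 2 : ℝ)| ≤ 2 := by split_ifs <;> norm_num
    have h2 := abs_eval_T_real_le_one n (hy l)
    calc _ ≤ 2 * |Λ (T ℝ n)| * 1 := by gcongr
      _ = _ := mul_one _
  · let Q : ℝ[X] →ₗ[ℝ] ℝ := (1 / (N : ℝ)) • ∑ l ∈ Finset.range N, r l • leval (y l)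
    have hQ : ∀ q, Q q = 1 / (N : ℝ) * ∑ l ∈ Finset.range N, r l * q.eval (y l) := fun q => by
      simp [Q, LinearMap.sum_apply]
    have hT : ∀ j < N, Q (T ℝ j) = Λ (T ℝ j) := fun j hj => by
      rw [hQ]
      simp_rw [r, Finset.sum_mul]
      rw [Finset.sum_comm, Finset.mul_sum]
      have : ∀ n ∈ Finset.range N, 1 / (N : ℝ) * ∑ l ∈ Finset.range N,
          (if n = 0 then 1 else 2) * Λ (T ℝ n) * (T ℝ n).eval (y l) * (T ℝ j).eval (y l) =
          if j = n then Λ (T ℝ n) else 0 := fun n hn => by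
        have := avg_nodes_T_mul_T (Nat.succ_ne_zero K) hj (Finset.mem_range.1 hn)
        have h2 : 1 / (N : ℝ) * ∑ l ∈ Finset.range N,
            (if n = 0 then 1 else 2) * Λ (T ℝ n) * (T ℝ n).eval (y l) * (T ℝ j).eval (y l) =
            (if n = 0 then 1 else 2) * Λ (T ℝ n) * (1 / (N : ℝ) * ∑ l ∈ Finset.range N,
              (T ℝ j).eval (y l) * (T ℝ n).eval (y l)) := by
          simp_rw [Finset.mul_sum]
          exact Finset.sum_congr rfl fun l _ => by ring
        rw [h2]
        refine (congrArg _ this).trans ?_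
        split_ifs <;> ring
      rw [Finset.sum_congr rfl this]
      simp [hj]
    have hspan : ∀ j ≤ K, (X ^ j : ℝ[X]) ∈
        Submodule.span ℝ (chebyshevTsequence ℝ '' Set.Iic K) := fun j hj => by
      rw [Polynomial.Sequence.span_degreeLE]
      · rw [mem_degreeLE]
        exact (degree_X_pow_le j).trans (by exact_mod_cast hj)
      · intro i _
        exact IsUnit.mk0 _ (leadingCoeff_ne_zero.2 (Polynomial.Sequence.ne_zero _ i))
    intro j hj
    have : Set.EqOn Q Λ (Submodule.span ℝ (chebyshevTsequence ℝ '' Set.Iic K)) := by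
      refine LinearMap.eqOn_span ?_
      rintro _ ⟨n, hn, rfl⟩
      exact hT n (Nat.lt_succ_of_le hn)
    have h := this (hspan j hj)
    rw [hQ] at h
    simpa [N] using h

theorem abs_T_sub_T_zero_le (n : ℕ) {z : ℝ} (hz0 : 0 ≤ z) (hz1 : z ≤ 1) :
    |(T ℝ n).eval 0 - (T ℝ n).eval z| ≤ 2 * (n * z) := by
  have h0 : (T ℝ n).eval 0 = Real.cos (n * (Real.pi / 2)) := by
    have := T_real_cos (Real.pi / 2) n
    rwa [Real.cos_pi_div_two] at this
  have h1 : (T ℝ n).eval z = Real.cos (n * Real.arccos z) := by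
    have := T_real_cos (Real.arccos z) n
    rwa [Real.cos_arccos (by linarith) hz1] at this
  rw [h0, h1]
  refine (Real.abs_cos_sub_cos_le _ _).trans ?_
  rw [← mul_sub, Real.arccos, sub_sub_cancel, abs_mul, Nat.abs_cast,
    abs_of_nonneg (Real.arcsin_nonneg.2 hz0), mul_left_comm]
  gcongr
  have h := Real.mul_le_sin (Real.arcsin_nonneg.2 hz0) (Real.arcsin_le_pi_div_two z)
  rw [Real.sin_arcsin (by linarith) hz1, div_mul_eq_mul_div, div_le_iff₀ Real.pi_pos] at h
  have := Real.pi_le_four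
  nlinarith

theorem abs_apply_X_pow_mul_T_le (E : ℝ[X] →ₗ[ℝ] ℝ) {C : ℝ} (hE : ∀ j, |E (X ^ j)| ≤ C) (n : ℕ) :
    ∀ i, |E (X ^ i * T ℝ n)| ≤ 3 ^ n * C := by
  have hC : 0 ≤ C := (abs_nonneg _).trans (hE 0)
  induction n using Nat.twoStepInduction with
  | zero => simpa using hE
  | one =>
    intro i
    have : X ^ i * T ℝ (1 : ℕ) = X ^ (i + 1) := by simp [pow_succ]
    rw [this]
    linarith [hE (i + 1)]
  | more n h1 h2 =>
    intro i
    have h : X ^ i * T ℝ (n + 2 : ℕ) =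
        (2 : ℝ) • (X ^ (i + 1) * T ℝ (n + 1 : ℕ)) - X ^ i * T ℝ n := by
      push_cast
      rw [T_add_two, smul_eq_C_mul, C_ofNat]
      ring
    rw [h, map_sub, map_smul, smul_eq_mul]
    have ha := abs_le.1 (h1 i)
    have hb := abs_le.1 (h2 (i + 1))
    have hp : 0 ≤ 3 ^ n * C := by positivity
    rw [pow_succ] at hb
    rw [show (3 : ℝ) ^ (n + 2) = 3 ^ n * 9 by ring]
    exact abs_le.2 ⟨by linarith, by linarith⟩

end chebyshev

/-! ### Tails -/

section tail

variable {m : ℕ}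

theorem pow_le_pow_mul_choose {m j : ℕ} (h : j ≤ m) : m ^ j ≤ j ^ j * m.choose j := by
  refine Nat.le_of_mul_le_mul_right ?_ j.factorial_pos
  rw [mul_assoc, mul_comm (m.choose j), ← Nat.descFactorial_eq_factorial_mul_choose,
    ← Nat.descFactorial_self j, Nat.descFactorial_eq_prod_range, Nat.descFactorial_eq_prod_range,
    ← Finset.card_range j, ← Finset.prod_const, ← Finset.prod_const, Finset.card_range,
    ← Finset.prod_mul_distrib, ← Finset.prod_mul_distrib]
  refine Finset.prod_le_prod' fun i hi => ?_
  have hi := Finset.mem_range.1 hi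
  rw [Nat.mul_sub, Nat.mul_sub, mul_comm m j]
  have := Nat.mul_le_mul_right i h
  omega

theorem pow_mul_fhat_sq_le {g : Cube m → ℝ}
    (hg : ∀ (σ : Equiv.Perm (Fin m)) x, g (x ∘ σ) = g x) (A : Finset (Fin m)) :
    (m : ℝ) ^ A.card * fhat g A ^ 2 ≤ (A.card : ℝ) ^ A.card * avg fun x => g x ^ 2 := by
  have hA : A.card ≤ m := (Finset.card_le_univ A).trans_eq (Fintype.card_fin m)
  have h₁ : (m.choose A.card : ℝ) * fhat g A ^ 2 ≤ avg fun x => g x ^ 2 := by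
    have hcard : (m.choose A.card : ℝ) =
        (Finset.powersetCard A.card (Finset.univ : Finset (Fin m))).card := by simp
    rw [parseval, hcard, ← nsmul_eq_mul, ← Finset.sum_const]
    refine (Finset.sum_le_sum fun B hB => ?_).trans (Finset.sum_le_sum_of_subset_of_nonneg
      (Finset.subset_univ (Finset.powersetCard A.card Finset.univ)) fun B _ _ => sq_nonneg _)
    rw [fhat_eq_of_card_eq hg (Finset.mem_powersetCard.1 hB).2]
  have h₂ : (m : ℝ) ^ A.card ≤ (A.card : ℝ) ^ A.card * m.choose A.card := by
    exact_mod_cast pow_le_pow_mul_choose hA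
  calc (m : ℝ) ^ A.card * fhat g A ^ 2
      ≤ (A.card : ℝ) ^ A.card * m.choose A.card * fhat g A ^ 2 := by gcongr
    _ = (A.card : ℝ) ^ A.card * (m.choose A.card * fhat g A ^ 2) := by ring
    _ ≤ _ := by gcongr

theorem avg_exp_mul_nsum_le (hm : 0 < m) (θ : ℝ) :
    avg (fun y : Cube m => Real.exp (θ * nsum y)) ≤ Real.exp (θ ^ 2 / 2) := by
  have h : ∀ y : Cube m, Real.exp (θ * nsum y) = ∏ i, Real.exp (θ / √(m : ℝ) * sgn (y i)) :=
    fun y => by rw [nsum, mul_div_left_comm, mul_comm, Finset.mul_sum, Real.exp_sum]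
  have hm' : (0 : ℝ) < m := by exact_mod_cast hm
  simp_rw [h]
  rw [avg_prod fun i b => Real.exp (θ / √(m : ℝ) * sgn b)]
  simp only [sgn_true, sgn_false, mul_one, mul_neg]
  rw [← Real.cosh_eq, Finset.prod_const, Finset.card_univ, Fintype.card_fin]
  calc Real.cosh (θ / √(m : ℝ)) ^ m ≤ Real.exp ((θ / √(m : ℝ)) ^ 2 / 2) ^ m := by
        gcongr
        exact Real.cosh_le_exp_half_sq _
    _ = Real.exp (θ ^ 2 / 2) := by
        rw [← Real.exp_nat_mul, div_pow, Real.sq_sqrt hm'.le]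
        congr 1
        field_simp

theorem avg_tail_sq_le (hm : 0 < m) {T : ℝ} (hT : 0 ≤ T) {g : Cube m → ℝ} (hg0 : ∀ y, 0 ≤ g y)
    (hg : ∀ y, g y ≤ if 6 * T < |nsum y| then Real.exp (T * |nsum y|) else 0) :
    avg (fun y => g y ^ 2) ≤ 2 * Real.exp (-(6 * T ^ 2)) := by
  have h : ∀ y, g y ^ 2 ≤ Real.exp (-(24 * T ^ 2)) *
      (Real.exp (6 * T * nsum y) + Real.exp (-(6 * T) * nsum y)) := fun y => by
    have hy := hg y
    split_ifs at hy with hs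
    · have h1 : g y ^ 2 ≤ Real.exp (-(24 * T ^ 2)) * Real.exp (6 * T * |nsum y|) := by
        refine (pow_le_pow_left₀ (hg0 y) hy 2).trans ?_
        rw [← Real.exp_nat_mul, ← Real.exp_add, Real.exp_le_exp]
        push_cast
        nlinarith
      refine h1.trans ?_
      gcongr
      rcases abs_choice (nsum y) with hn | hn <;> rw [hn]
      · linarith [Real.exp_pos (-(6 * T) * nsum y)]
      · rw [mul_neg, ← neg_mul]
        linarith [Real.exp_pos (6 * T * nsum y)]
    · have : g y = 0 := le_antisymm hy (hg0 y)
      rw [this, zero_pow two_ne_zero]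
      positivity
  refine (avg_mono h).trans ?_
  rw [avg_const_mul, avg_add]
  have h1 := avg_exp_mul_nsum_le hm (6 * T)
  have h2 := avg_exp_mul_nsum_le hm (-(6 * T))
  rw [neg_sq] at h2
  calc _ ≤ Real.exp (-(24 * T ^ 2)) *
        (Real.exp ((6 * T) ^ 2 / 2) + Real.exp ((6 * T) ^ 2 / 2)) := by gcongr
    _ = 2 * (Real.exp (-(24 * T ^ 2)) * Real.exp ((6 * T) ^ 2 / 2)) := by ring
    _ = _ := by
      rw [← Real.exp_add]
      congr 2
      ring

end tail

/-! ### Densities close to a product density with vanishing low-degree Fourier coefficients -/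

section matching

variable {m : ℕ}

open Polynomial in
/-- Bounded weights at the Chebyshev nodes of `[-T, T]` whose moments are those of the origin, minus
those of `2 * δ`, minus a small multiple of a given bounded sequence. -/
theorem exists_matching_weights (K : ℕ) {T δ l C : ℝ} (hT : 0 < T) (hδ : 0 ≤ δ) (hl : 0 ≤ l)
    (hδT : 2 * δ ≤ T) (hmom : 4 * (K * (K + 1)) * δ / T ≤ l / 2) (hC : C * 3 ^ (K + 1) ≤ 1 / 2) :
    ∃ x : ℕ → ℝ, (∀ i, |x i| ≤ T) ∧ ∀ t : ℕ → ℝ, (∀ j, |t j| ≤ C * T ^ j) → ∃ r : ℕ → ℝ,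
      (∀ i, |r i| ≤ l) ∧ ∀ j ≤ K, 1 / ((K + 1 : ℕ) : ℝ) * ∑ i ∈ Finset.range (K + 1),
        r i * x i ^ j = 0 ^ j - (2 * δ) ^ j - l * t j := by
  obtain ⟨y, hy, hΛ⟩ := exists_chebyshev_nodes K
  refine ⟨fun i => T * y i, fun i => ?_, fun t ht => ?_⟩
  · rw [abs_mul, abs_of_pos hT]
    exact mul_le_of_le_one_right hT.le (hy i)
  let E : ℝ[X] →ₗ[ℝ] ℝ := (Polynomial.basisMonomials ℝ).constr ℝ fun j => t j / T ^ j
  have hE : ∀ j, E (X ^ j) = t j / T ^ j := fun j => by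
    have := (Polynomial.basisMonomials ℝ).constr_basis ℝ (fun j => t j / T ^ j) j
    simp only [coe_basisMonomials, monomial_one_right_eq_X_pow] at this
    exact this
  have hEC : ∀ j, |E (X ^ j)| ≤ C := fun j => by
    rw [hE, abs_div, abs_of_pos (pow_pos hT j), div_le_iff₀ (pow_pos hT j)]
    exact ht j
  set z : ℝ := 2 * δ / T with hz
  have hz0 : 0 ≤ z := by positivity
  have hz1 : z ≤ 1 := (div_le_one hT).2 hδT
  let Λ : ℝ[X] →ₗ[ℝ] ℝ := leval 0 - leval z - l • E
  have hΛa : ∀ q, Λ q = q.eval 0 - q.eval z - l * E q := fun q => by simp [Λ]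
  obtain ⟨r, hr, hmo⟩ := hΛ Λ
  refine ⟨r, fun i => (hr i).trans ?_, fun j hj => ?_⟩
  · have h1 : ∀ n : ℕ, |Λ (Chebyshev.T ℝ n)| ≤ 2 * (n * z) + l * (3 ^ n * C) := fun n => by
      rw [hΛa]
      refine (abs_sub _ _).trans (add_le_add (abs_T_sub_T_zero_le n hz0 hz1) ?_)
      rw [abs_mul, abs_of_nonneg hl]
      have := abs_apply_X_pow_mul_T_le E hEC n 0
      rw [pow_zero, one_mul] at this
      gcongr
    have h2 : ∑ n ∈ Finset.range (K + 1), (2 * (n * z) + l * (3 ^ n * C)) =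
        K * (K + 1) * z + l * C * ((3 ^ (K + 1) - 1) / 2) := by
      rw [Finset.sum_add_distrib, ← Finset.mul_sum, ← Finset.mul_sum, ← Finset.sum_mul,
        ← Finset.sum_mul, geom_sum_eq (by norm_num)]
      have := Finset.sum_range_id_mul_two (K + 1)
      have h3 : (∑ i ∈ Finset.range (K + 1), (i : ℝ)) * 2 = (K + 1) * K := by
        rw [Nat.add_sub_cancel] at this
        have := congrArg (Nat.cast (R := ℝ)) this
        push_cast at this
        exact this
      linear_combination z * h3
    have hC0 : 0 ≤ C := (abs_nonneg _).trans (hEC 0)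
    calc 2 * ∑ n ∈ Finset.range (K + 1), |Λ (Chebyshev.T ℝ n)|
        ≤ 2 * (K * (K + 1) * z + l * C * ((3 ^ (K + 1) - 1) / 2)) := by
          rw [← h2]
          gcongr
          exact h1 _
      _ = 4 * (K * (K + 1)) * δ / T + l * (C * 3 ^ (K + 1)) - l * C := by
          rw [hz]
          ring
      _ ≤ l / 2 + l * (1 / 2) - 0 := by
          gcongr
          positivity
      _ = l := by ring
  · have h1 : ∑ i ∈ Finset.range (K + 1), r i * (T * y i) ^ j =
        T ^ j * ∑ i ∈ Finset.range (K + 1), r i * y i ^ j := by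
      rw [Finset.mul_sum]
      exact Finset.sum_congr rfl fun i _ => by rw [mul_pow]; ring
    rw [h1, mul_left_comm, hmo j hj, hΛa, hE]
    simp only [eval_pow, eval_X]
    have h2 : T ^ j * z ^ j = (2 * δ) ^ j := by
      rw [← mul_pow, hz, mul_div_cancel₀ _ hT.ne']
    have h3 : T ^ j * (0 : ℝ) ^ j = 0 ^ j := by rw [← mul_pow, mul_zero]
    have h4 : T ^ j * (l * (t j / T ^ j)) = l * t j := by
      field_simp
    linear_combination h3 - h2 - h4

/-- A symmetric density on the cube that is close to the one of a product distribution with bias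
`δ / √m`, and all of whose Fourier coefficients of degree between `1` and `K` vanish. -/
theorem exists_matching_density {K : ℕ} (hK : 1 ≤ K) (hKm : K ≤ m) {T δ l : ℝ} (hT : 1 ≤ T)
    (hTm : T ≤ √(m : ℝ)) (hδ : 0 ≤ δ) (hl : 0 ≤ l) (hδT : 2 * δ ≤ T)
    (hδm : 2 * δ / √(m : ℝ) ≤ 1 / 2) (hbulk : 12 * δ * T + 8 * δ ^ 2 ≤ 1 / 2)
    (hlT : l * Real.exp (6 * T ^ 2) ≤ 1 / 2)
    (htail : 8 * 9 ^ (K + 1) * (K : ℝ) ^ K ≤ Real.exp (6 * T ^ 2))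
    (hmom : 4 * (K * (K + 1)) * δ / T ≤ l / 2) :
    ∃ g : Cube m → ℝ, (∀ y, 0 ≤ g y) ∧ avg g = 1 ∧
      (∀ A : Finset (Fin m), A ≠ ∅ → A.card ≤ K → fhat g A = 0) ∧
      (∀ (σ : Equiv.Perm (Fin m)) y, g (y ∘ σ) = g y) ∧
      (avg (fun y => g y ^ 2) ≤ 2 * Real.exp (4 * δ ^ 2) + 8 * l ^ 2 * Real.exp (T ^ 2)) ∧
      (avg (fun y => |g y - tilt (2 * δ) y|) ≤ 2 * l) := by
  classical
  have hm : 0 < m := by omega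
  have hm' : (0 : ℝ) < m := by exact_mod_cast hm
  have hs : 0 < √(m : ℝ) := Real.sqrt_pos.2 hm'
  have hT0 : 0 < T := by linarith
  have hK1 : (1 : ℝ) ≤ K := by exact_mod_cast hK
  set C : ℝ := √(2 * (K : ℝ) ^ K * Real.exp (-(6 * T ^ 2))) with hC
  have hCsq : C ^ 2 = 2 * (K : ℝ) ^ K * Real.exp (-(6 * T ^ 2)) := Real.sq_sqrt (by positivity)
  have hC3 : C * 3 ^ (K + 1) ≤ 1 / 2 := by
    refine (le_abs_self _).trans (abs_le_of_sq_le_sq ?_ (by norm_num))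
    have h9 : ((3 : ℝ) ^ (K + 1)) ^ 2 = 9 ^ (K + 1) := by
      rw [← pow_mul, mul_comm, pow_mul]
      norm_num
    have h1 := mul_le_mul_of_nonneg_right htail (Real.exp_pos (-(6 * T ^ 2))).le
    rw [← Real.exp_add, add_neg_cancel, Real.exp_zero] at h1
    rw [mul_pow, hCsq, h9]
    linarith
  obtain ⟨x, hxT, hw⟩ := exists_matching_weights K hT0 hδ hl hδT hmom hC3
  set N : ℕ := K + 1 with hN
  have hN0 : (0 : ℝ) < (N : ℝ) := by positivity
  have hx1 : ∀ i, |x i / √(m : ℝ)| ≤ 1 := fun i => by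
    rw [abs_div, abs_of_pos hs, div_le_one hs]
    exact (hxT i).trans hTm
  have hle : ∀ i y, tilt (m := m) (x i) y ≤ Real.exp (T * |nsum y|) := fun i y =>
    (tilt_le_exp (hx1 i) y).trans (Real.exp_le_exp.2 ((le_abs_self _).trans (by
      rw [abs_mul]
      gcongr
      exact hxT i)))
  -- the average of the product densities at the nodes
  let a : Cube m → ℝ := fun y => 1 / (N : ℝ) * ∑ i ∈ Finset.range N, tilt (x i) y
  let χ : Cube m → ℝ := fun y => if 6 * T < |nsum y| then 1 else 0
  have ha0 : ∀ y, 0 ≤ a y := fun y => mul_nonneg (by positivity)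
    (Finset.sum_nonneg fun i _ => tilt_nonneg (hx1 i) y)
  have hχ : ∀ y, χ y = 0 ∨ χ y = 1 := fun y => by
    by_cases h : 6 * T < |nsum y| <;> simp [χ, h]
  have hale : ∀ y, a y ≤ Real.exp (T * |nsum y|) := fun y => by
    have : ∑ i ∈ Finset.range N, tilt (x i) y ≤ N * Real.exp (T * |nsum y|) := by
      have := Finset.sum_le_sum fun i (_ : i ∈ Finset.range N) => hle i y
      simpa using this
    calc a y ≤ 1 / (N : ℝ) * (N * Real.exp (T * |nsum y|)) :=
          mul_le_mul_of_nonneg_left this (by positivity)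
      _ = _ := by field_simp
  have havg : avg a = 1 := by
    simp only [a]
    rw [avg_const_mul, avg_sum]
    simp_rw [avg_tilt]
    simp [hN0.ne']
  have havg2 : avg (fun y => a y ^ 2) ≤ Real.exp (T ^ 2) := by
    have h1 : ∀ y, a y ^ 2 ≤ 1 / (N : ℝ) * ∑ i ∈ Finset.range N, tilt (x i) y ^ 2 := fun y => by
      have := sq_sum_le_card_mul_sum_sq (s := Finset.range N) (f := fun i => tilt (x i) y)
      rw [Finset.card_range] at this
      calc a y ^ 2 = (1 / (N : ℝ)) ^ 2 * (∑ i ∈ Finset.range N, tilt (x i) y) ^ 2 := mul_pow _ _ _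
        _ ≤ (1 / (N : ℝ)) ^ 2 * (N * ∑ i ∈ Finset.range N, tilt (x i) y ^ 2) := by gcongr
        _ = _ := by field_simp
    refine (avg_mono h1).trans ?_
    rw [avg_const_mul, avg_sum]
    have h2 : ∀ i ∈ Finset.range N, avg (fun y : Cube m => tilt (x i) y ^ 2) ≤ Real.exp (T ^ 2) :=
      fun i _ => (avg_tilt_sq hm _).trans (Real.exp_le_exp.2 (sq_le_sq.2 (by
        rw [abs_of_pos hT0]; exact hxT i)))
    have h3 := Finset.sum_le_sum h2
    rw [Finset.sum_const, Finset.card_range, nsmul_eq_mul] at h3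
    calc _ ≤ 1 / (N : ℝ) * (N * Real.exp (T ^ 2)) := by gcongr
      _ = _ := by field_simp
  let w : Cube m → ℝ := fun y => χ y * a y
  have hw0 : ∀ y, 0 ≤ w y := fun y => by
    rcases hχ y with h | h <;> simp [w, h, ha0]
  have haσ : ∀ (σ : Equiv.Perm (Fin m)) y, a (y ∘ σ) = a y := fun σ y => by
    simp only [a, tilt_comp_perm]
  have hwσ : ∀ (σ : Equiv.Perm (Fin m)) y, w (y ∘ σ) = w y := fun σ y => by
    simp only [w, χ, nsum_comp_perm, haσ]
  have hwsq : avg (fun y => w y ^ 2) ≤ 2 * Real.exp (-(6 * T ^ 2)) := by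
    refine avg_tail_sq_le hm hT0.le hw0 fun y => ?_
    by_cases h : 6 * T < |nsum y| <;> simp [w, χ, h, hale]
  choose S hS using fun j : ℕ => (show ∃ A : Finset (Fin m), j ≤ K → A.card = j by
    rcases le_or_gt j K with h | h
    · obtain ⟨A, -, hA⟩ := Finset.exists_subset_card_eq
        (s := (Finset.univ : Finset (Fin m))) (n := j) (by simp; omega)
      exact ⟨A, fun _ => hA⟩
    · exact ⟨∅, fun h' => absurd h' (by omega)⟩)
  let t : ℕ → ℝ := fun j => if j ≤ K then √(m : ℝ) ^ j * fhat w (S j) else 0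
  have ht : ∀ j, |t j| ≤ C * T ^ j := fun j => by
    have hC0 : 0 ≤ C := Real.sqrt_nonneg _
    by_cases hj : j ≤ K
    · have h1 : |t j| ≤ C := by
        simp only [t, hj, if_true]
        refine abs_le_of_sq_le_sq ?_ hC0
        have h2 := pow_mul_fhat_sq_le hwσ (S j)
        rw [hS j hj] at h2
        rw [mul_pow, ← pow_mul, mul_comm j 2, pow_mul, Real.sq_sqrt hm'.le, hCsq]
        refine h2.trans ?_
        have h3 : (j : ℝ) ^ j ≤ (K : ℝ) ^ K := by
          calc (j : ℝ) ^ j ≤ (K : ℝ) ^ j := by gcongr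
            _ ≤ (K : ℝ) ^ K := pow_le_pow_right₀ hK1 hj
        have h4 : 0 ≤ avg (fun y => w y ^ 2) := avg_nonneg fun y => sq_nonneg _
        calc _ ≤ (K : ℝ) ^ K * (2 * Real.exp (-(6 * T ^ 2))) := by gcongr
          _ = _ := by ring
      exact h1.trans (le_mul_of_one_le_right hC0 (one_le_pow₀ hT))
    · simp only [t, hj, if_false, abs_zero]
      positivity
  obtain ⟨r, hr, hmo⟩ := hw t ht
  let d : Cube m → ℝ := fun y => 1 / (N : ℝ) * ∑ i ∈ Finset.range N, r i * tilt (x i) y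
  let g : Cube m → ℝ := fun y => tilt (2 * δ) y + (d y + l * w y)
  have hd : ∀ y, |d y| ≤ l * a y := fun y => by
    simp only [d, a]
    rw [abs_mul, abs_of_pos (by positivity : 0 < 1 / (N : ℝ)), mul_left_comm, Finset.mul_sum]
    gcongr
    refine (Finset.abs_sum_le_sum_abs _ _).trans (Finset.sum_le_sum fun i _ => ?_)
    rw [abs_mul, abs_of_nonneg (tilt_nonneg (hx1 i) y)]
    exact mul_le_mul_of_nonneg_right (hr i) (tilt_nonneg (hx1 i) y)
  have hδm1 : |2 * δ / √(m : ℝ)| ≤ 1 / 2 := by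
    rwa [abs_of_nonneg (by positivity)]
  have hu0 : ∀ y, 0 ≤ tilt (m := m) (2 * δ) y := tilt_nonneg (hδm1.trans (by norm_num))
  have hgd : ∀ y, |g y - tilt (2 * δ) y| ≤ 2 * l * a y := fun y => by
    simp only [g, add_sub_cancel_left]
    refine (abs_add_le _ _).trans ?_
    rw [abs_of_nonneg (mul_nonneg hl (hw0 y))]
    have h1 : w y ≤ a y := by
      rcases hχ y with h | h <;> simp [w, h, ha0]
    have := mul_le_mul_of_nonneg_left h1 hl
    linarith [hd y]
  have hfhat : ∀ A : Finset (Fin m), A.card ≤ K → fhat g A = 0 ^ A.card := fun A hA => by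
    simp only [g, d]
    rw [fhat_add, fhat_add, fhat_const_mul, fhat_const_mul, fhat_sum]
    simp_rw [fhat_const_mul, fhat_tilt, div_pow]
    have h1 : fhat w A = fhat w (S A.card) := fhat_eq_of_card_eq hwσ (hS _ hA).symm
    have h2 := hmo A.card hA
    have h3 : t A.card = √(m : ℝ) ^ A.card * fhat w A := by
      simp only [t, hA, if_true, h1]
    rw [h3] at h2
    have hp : 0 < √(m : ℝ) ^ A.card := pow_pos hs _
    have h4 : ∑ i ∈ Finset.range N, r i * (x i ^ A.card / √(m : ℝ) ^ A.card) =
        (∑ i ∈ Finset.range N, r i * x i ^ A.card) / √(m : ℝ) ^ A.card := by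
      rw [Finset.sum_div]
      exact Finset.sum_congr rfl fun i _ => by ring
    rw [h4]
    have h5 : (0 : ℝ) ^ A.card * √(m : ℝ) ^ A.card = 0 ^ A.card := by
      rcases A.card.eq_zero_or_pos with h | h
      · simp [h]
      · simp [zero_pow h.ne']
    refine mul_right_cancel₀ hp.ne' ?_
    rw [h5, add_mul, add_mul, div_mul_cancel₀ _ hp.ne', mul_assoc, div_mul_cancel₀ _ hp.ne', h2]
    ring
  refine ⟨g, fun y => ?_, ?_, fun A hA hAK => ?_, fun σ y => ?_, ?_, ?_⟩
  · have hdy := (abs_le.1 (hd y)).1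
    by_cases h : 6 * T < |nsum y|
    · have : w y = a y := by simp [w, χ, h]
      simp only [g, this]
      linarith [hu0 y]
    · have hwy : w y = 0 := by simp [w, χ, h]
      have hn : |nsum y| ≤ 6 * T := not_lt.1 h
      simp only [g, hwy, mul_zero, add_zero]
      have h1 : l * a y ≤ 1 / 2 := by
        refine le_trans (mul_le_mul_of_nonneg_left ((hale y).trans (Real.exp_le_exp.2 ?_)) hl) hlT
        nlinarith
      have h2 : 1 / 2 ≤ tilt (2 * δ) y := by
        refine le_trans ?_ (exp_le_tilt hm hδm1 y)
        refine le_trans ?_ (Real.add_one_le_exp _)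
        have := (abs_le.1 hn).1
        nlinarith
      linarith
  · rw [← fhat_empty, hfhat ∅ (by simp)]
    simp
  · rw [hfhat A hAK, zero_pow (Finset.card_ne_zero.2 (Finset.nonempty_iff_ne_empty.2 hA))]
  · simp only [g, d, tilt_comp_perm, hwσ]
  · have h1 : ∀ y, g y ^ 2 ≤ 2 * tilt (2 * δ) y ^ 2 + 8 * l ^ 2 * a y ^ 2 := fun y => by
      have h2 : (g y - tilt (2 * δ) y) ^ 2 ≤ (2 * l * a y) ^ 2 :=
        sq_le_sq' (by linarith [(abs_le.1 (hgd y)).1]) (abs_le.1 (hgd y)).2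
      nlinarith [sq_nonneg (g y - 2 * tilt (2 * δ) y)]
    refine (avg_mono h1).trans ?_
    rw [avg_add, avg_const_mul, avg_const_mul]
    have h2 := avg_tilt_sq hm (2 * δ)
    rw [show (2 * δ) ^ 2 = 4 * δ ^ 2 by ring] at h2
    gcongr
  · refine (avg_mono hgd).trans ?_
    rw [avg_const_mul, havg, mul_one]

end matching

/-! ### The lower bound for a family of embedded copies of a density -/

section lowerBound

variable {m M : ℕ}

theorem choose_mul_pow_le {i m : ℕ} (h : i ≤ m) (j : ℕ) :
    i.choose j * m ^ j ≤ m.choose j * i ^ j := by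
  refine Nat.le_of_mul_le_mul_left ?_ j.factorial_pos
  rw [← mul_assoc, ← mul_assoc, ← Nat.descFactorial_eq_factorial_mul_choose,
    ← Nat.descFactorial_eq_factorial_mul_choose, Nat.descFactorial_eq_prod_range,
    Nat.descFactorial_eq_prod_range, ← Finset.card_range j, ← Finset.prod_const,
    ← Finset.prod_const, Finset.card_range, ← Finset.prod_mul_distrib, ← Finset.prod_mul_distrib]
  refine Finset.prod_le_prod' fun a _ => ?_
  rw [Nat.sub_mul, Nat.sub_mul, mul_comm i m]
  exact Nat.sub_le_sub_left (Nat.mul_le_mul_left a h) _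

/-- The correlation of two copies of a symmetric function without low-degree Fourier coefficients
that share the coordinates in `I`. -/
theorem sum_fhat_sq_le_of_card {g : Cube m → ℝ} (hm : 0 < m)
    (hg : ∀ (σ : Equiv.Perm (Fin m)) x, g (x ∘ σ) = g x) {K : ℕ}
    (hK : ∀ A : Finset (Fin m), A ≠ ∅ → A.card ≤ K → fhat g A = 0) (I : Finset (Fin m)) :
    ∑ A ∈ I.powerset.erase ∅, fhat g A ^ 2 ≤
      ((I.card : ℝ) / m) ^ (K + 1) * avg fun x => g x ^ 2 := by
  have hm' : (0 : ℝ) < m := by exact_mod_cast hm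
  have hIm : I.card ≤ m := (Finset.card_le_univ I).trans_eq (Fintype.card_fin m)
  obtain ⟨γ, hγ0, hγ⟩ : ∃ γ : ℕ → ℝ, (∀ j, 0 ≤ γ j) ∧
      ∀ A : Finset (Fin m), γ A.card = if A.card ≤ K then 0 else fhat g A ^ 2 := by
    classical
    refine ⟨fun j => if h : ∃ A : Finset (Fin m), A.card = j ∧ K < j then
      fhat g h.choose ^ 2 else 0, fun j => ?_, fun A => ?_⟩
    · dsimp only
      split_ifs <;> positivity
    · dsimp only
      by_cases hA : A.card ≤ K
      · rw [dif_neg (by rintro ⟨-, -, h⟩; omega), if_pos hA]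
      · have h : ∃ B : Finset (Fin m), B.card = A.card ∧ K < A.card := ⟨A, rfl, not_le.1 hA⟩
        rw [dif_pos h, if_neg hA, fhat_eq_of_card_eq hg h.choose_spec.1]
  have hle1 : ((I.card : ℝ) / m) ≤ 1 := by
    rw [div_le_one hm']
    exact_mod_cast hIm
  have h1 : ∑ A ∈ I.powerset.erase ∅, fhat g A ^ 2 ≤ ∑ A ∈ I.powerset, γ A.card := by
    refine (Finset.sum_le_sum fun A hA => ?_).trans (Finset.sum_le_sum_of_subset_of_nonneg
      (Finset.erase_subset _ _) fun A _ _ => hγ0 _)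
    rw [hγ]
    split_ifs with hAK
    · rw [hK A (Finset.ne_of_mem_erase hA) hAK]
      simp
    · rfl
  have h2 : ∀ j, (I.card.choose j : ℝ) * γ j ≤
      ((I.card : ℝ) / m) ^ (K + 1) * (m.choose j * γ j) := fun j => by
    rcases le_or_gt j K with hj | hj
    · rcases le_or_gt j m with hjm | hjm
      · obtain ⟨A, -, rfl⟩ := Finset.exists_subset_card_eq
          (s := (Finset.univ : Finset (Fin m))) (n := j) (by simpa using hjm)
        rw [hγ, if_pos hj]
        simp
      · rw [Nat.choose_eq_zero_of_lt (by omega), Nat.choose_eq_zero_of_lt hjm]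
        simp
    · have h3 : (I.card.choose j : ℝ) * m ^ j ≤ m.choose j * I.card ^ j := by
        exact_mod_cast choose_mul_pow_le hIm j
      have h4 : (I.card.choose j : ℝ) ≤ m.choose j * ((I.card : ℝ) / m) ^ j := by
        rw [div_pow, ← mul_div_assoc, le_div_iff₀ (by positivity)]
        exact h3
      have h5 : ((I.card : ℝ) / m) ^ j ≤ ((I.card : ℝ) / m) ^ (K + 1) :=
        pow_le_pow_of_le_one (by positivity) hle1 hj
      calc (I.card.choose j : ℝ) * γ j
          ≤ m.choose j * ((I.card : ℝ) / m) ^ (K + 1) * γ j := by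
            refine mul_le_mul_of_nonneg_right (h4.trans ?_) (hγ0 j)
            gcongr
        _ = _ := by ring
  have h3 : ∑ A : Finset (Fin m), γ A.card ≤ avg fun x => g x ^ 2 := by
    rw [parseval]
    refine Finset.sum_le_sum fun A _ => ?_
    rw [hγ]
    split_ifs
    · positivity
    · rfl
  rw [← Finset.powerset_univ, Finset.sum_powerset_apply_card, Finset.card_univ,
    Fintype.card_fin] at h3
  rw [Finset.sum_powerset_apply_card] at h1
  simp_rw [nsmul_eq_mul] at h1 h3
  refine h1.trans ((Finset.sum_le_sum fun j _ => h2 j).trans ?_)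
  rw [← Finset.mul_sum]
  refine mul_le_mul_of_nonneg_left (le_trans ?_ h3) (by positivity)
  exact Finset.sum_le_sum_of_subset_of_nonneg (Finset.range_mono (by omega))
    fun j _ _ => mul_nonneg (Nat.cast_nonneg _) (hγ0 j)

open MeasureTheory in
theorem exists_oracle_of_density {L t : ℕ} (hL : 0 < L) (hML : m * L ≤ M) {g : Cube m → ℝ}
    (g0 : ∀ y, 0 ≤ g y) (g1 : avg g = 1) {τ₀ τ β err W Kq : ℝ} (hτ0 : 0 < τ₀) (hτ : τ₀ ≤ τ)
    (hβ : ∀ I : Finset (Fin m), ∑ A ∈ I.powerset.erase ∅, fhat g A ^ 2 ≤ β)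
    (hlo : ∀ I : Finset (Fin m), I.card ≤ t → ∑ A ∈ I.powerset.erase ∅, fhat g A ^ 2 ≤ τ₀)
    (hfar : ∀ e e' : Fin m ↪ Fin M, (∀ i j, e i = e' j → i = j) → (agree e e').card ≤ t →
      ∃ φ : Cube M → ℝ, (∀ x, |φ x| ≤ 1) ∧
        4 * err < |avg (fun x => g (x ∘ e) * φ x) - avg (fun x => g (x ∘ e') * φ x)|)
    {𝒟 : Set (PMF (Cube M))}
    (h𝒟 : ∀ e : Fin m ↪ Fin M, densityPMF (fun x => g (x ∘ e)) (fun _ => g0 _)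
      ((avg_comp e g).trans g1) ∈ 𝒟)
    (hW : ((L : ℝ) + 1) ^ m ≤ W * 2 ^ t) (hW6 : W ≤ (L : ℝ) ^ m / 6)
    (hKq0 : 0 ≤ Kq) (hKq : Kq * (W * β / τ₀) ≤ (L : ℝ) ^ m / 6)
    {Ω : Type*} [MeasurableSpace Ω] (ν : Measure Ω) [IsProbabilityMeasure ν] (A : Ω → SQAlg M)
    (hA : LearnsWithProb ν A 𝒟 err (2 / 3)) :
    ∃ P ∈ 𝒟, ∃ O : StatQuery M → ℝ, IsStatOracle P O ∧
      ∃ᵐ ω ∂ν, (∃ q ∈ (A ω).queries O, q.tol < √(2 * τ)) ∨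
        Kq ≤ (((A ω).queries O).length : ℝ) := by
  classical
  obtain ⟨ι⟩ : Nonempty (Fin m × Fin L ↪ Fin M) :=
    Function.Embedding.nonempty_of_card_le (by simpa using hML)
  let e : (Fin m → Fin L) → Fin m ↪ Fin M := fun f =>
    ⟨fun i => ι (i, f i), fun i j h => (Prod.mk.inj (ι.injective h)).1⟩
  have he : ∀ f f' i j, e f i = e f' j → i = j := fun f f' i j h =>
    (Prod.mk.inj (ι.injective h)).1
  have hagree : ∀ f f', agree (e f) (e f') = Finset.univ.filter fun i => f i = f' i :=
    fun f f' => Finset.filter_congr fun i _ =>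
      (ι.injective.eq_iff (a := (i, f i)) (b := (i, f' i))).trans (by simp)
  have hcount : ∀ f, ((Finset.univ.filter fun f' =>
      t < (agree (e f) (e f')).card).card : ℝ) ≤ W := fun f => by
    have h := card_agree_mul_two_pow_le f t
    simp_rw [hagree]
    have h' : ((Finset.univ.filter fun f' : Fin m → Fin L =>
      t < (Finset.univ.filter fun i => f i = f' i).card).card : ℝ) * 2 ^ t ≤ ((L : ℝ) + 1) ^ m := by
      exact_mod_cast h
    exact le_of_mul_le_mul_right (h'.trans hW) (by positivity)
  have : Nonempty (Fin m → Fin L) := ⟨fun _ => ⟨0, hL⟩⟩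
  have hτpos : 0 < τ := hτ0.trans_le hτ
  have hW0 : 0 ≤ W := (Nat.cast_nonneg _).trans (hcount (Classical.arbitrary _))
  have hβ0 : 0 ≤ β := by simpa using hβ ∅
  let P : (Fin m → Fin L) → PMF (Cube M) := fun f =>
    densityPMF (fun x => g (x ∘ e f)) (fun x => g0 _) ((avg_comp (e f) g).trans g1)
  let D : PMF (Cube M) := densityPMF (fun _ => 1) (fun _ => zero_le_one) avg_one
  have hcard : (Fintype.card (Fin m → Fin L) : ℝ) = (L : ℝ) ^ m := by simp
  refine exists_oracle_of_family P D (θ := √(2 * τ)) (B := W * β / τ) (err := err) (K := Kq)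
    (by positivity) (fun q hq => ?_) ?_ (fun f => ?_) (fun f => h𝒟 (e f)) ν A hA
  · refine card_distinguished_le e he g1 hτpos hβ (fun I hI => (hlo I hI).trans hτ) hcount
      (φ := q.f) (fun x => abs_le.2 (q.bounded x)) _ fun f hf => ?_
    have h1 := not_le.1 (Finset.mem_filter.1 hf).2
    have h2 : avg (fun x => (g (x ∘ e f) - 1) * q.f x) =
        expect (P f) q.f - expect D q.f := by
      rw [expect_densityPMF, expect_densityPMF, ← avg_sub]
      exact congrArg avg (funext fun x => by ring)
    rw [h2, abs_sub_comm]
    exact hq.trans h1.le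
  · rw [hcard]
    refine le_trans ?_ hKq
    gcongr
  · refine ⟨_, (hcount f).trans (by rw [hcard]; exact hW6), fun f' hf' => ?_⟩
    obtain ⟨φ, hφ, h⟩ := hfar (e f) (e f') (he f f') (by simpa using hf')
    exact ⟨φ, hφ, by rwa [expect_densityPMF, expect_densityPMF]⟩

end lowerBound

/-! ### The density that hides the biased coordinates -/

section parityAndBias

variable {m : ℕ}

theorem avg_abs_tilt_sub_one_le (hm : 0 < m) {δ : ℝ} (hδ0 : 0 ≤ δ) (hδ : δ ≤ 1 / 8) :
    avg (fun y : Cube m => |tilt (2 * δ) y - 1|) ≤ 3 * δ := by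
  have h1 := avg_abs_sq_le fun y : Cube m => tilt (2 * δ) y - 1
  have h2 : avg (fun y : Cube m => (tilt (2 * δ) y - 1) ^ 2) =
      avg (fun y : Cube m => tilt (2 * δ) y ^ 2) - 1 := by
    have h3 : ∀ y : Cube m, (tilt (2 * δ) y - 1) ^ 2 =
        tilt (2 * δ) y ^ 2 - (2 * tilt (2 * δ) y - 1) := fun y => by ring
    simp_rw [h3]
    rw [avg_sub, avg_sub, avg_const_mul, avg_tilt, avg_one]
    norm_num
  have h3 := avg_tilt_sq hm (2 * δ)
  have h4 : |(2 * δ) ^ 2| = (2 * δ) ^ 2 := abs_of_nonneg (sq_nonneg _)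
  have h5 := (abs_le.1 (Real.abs_exp_sub_one_le (x := (2 * δ) ^ 2) (by rw [h4]; nlinarith))).2
  rw [h4] at h5
  refine (le_abs_self _).trans (abs_le_of_sq_le_sq ?_ (by positivity))
  nlinarith

theorem fhat_one_add_parity {δ : ℝ} (A : Finset (Fin m)) :
    fhat (fun y => 1 + δ * chi Finset.univ y) A =
      (if A = ∅ then 1 else 0) + δ * if A = Finset.univ then 1 else 0 := by
  rw [fhat_add, fhat_const_mul]
  have h1 := avg_chi_mul_chi (∅ : Finset (Fin m)) A
  have h2 := avg_chi_mul_chi (Finset.univ : Finset (Fin m)) A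
  simp_rw [chi_empty] at h1
  rw [fhat, fhat, h1, h2]
  simp only [eq_comm]

/-- A density on the cube, within `ε` of the one of a product distribution with bias `δ / √m`,
whose embedded copies are hard to tell from the uniform distribution and far from each other. -/
def IsHidingDensity (M t : ℕ) (δ ε β τ : ℝ) (g : Cube m → ℝ) : Prop :=
  (∀ y, 0 ≤ g y) ∧ avg g = 1 ∧ avg (fun y => |g y - tilt (2 * δ) y|) ≤ ε ∧
    (∀ I : Finset (Fin m), ∑ A ∈ I.powerset.erase ∅, fhat g A ^ 2 ≤ β) ∧
    (∀ I : Finset (Fin m), I.card ≤ t → ∑ A ∈ I.powerset.erase ∅, fhat g A ^ 2 ≤ τ) ∧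
    ∀ e e' : Fin m ↪ Fin M, (∀ i j, e i = e' j → i = j) → (agree e e').card ≤ t →
      ∃ φ : Cube M → ℝ, (∀ x, |φ x| ≤ 1) ∧
        δ / 8 < |avg (fun x => g (x ∘ e) * φ x) - avg (fun x => g (x ∘ e') * φ x)|

theorem isHidingDensity_parity {M t : ℕ} (htm : t < m) {δ ε τ : ℝ} (hδ0 : 0 < δ)
    (hδ : δ ≤ 1 / 8) (hδε : 4 * δ ≤ ε) (hτ : 0 ≤ τ) :
    IsHidingDensity M t δ ε (δ ^ 2) τ fun y : Cube m => 1 + δ * chi Finset.univ y := by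
  have hm : 0 < m := by omega
  have hne : (∅ : Finset (Fin m)) ≠ Finset.univ := by
    intro h
    have := congrArg Finset.card h
    simp at this
    omega
  have hlo : ∀ I : Finset (Fin m), I.card ≤ t →
      ∑ A ∈ I.powerset.erase ∅, fhat (fun y => 1 + δ * chi Finset.univ y) A ^ 2 = 0 :=
    fun I hI => Finset.sum_eq_zero fun A hA => by
      obtain ⟨hA0, hAI⟩ := Finset.mem_erase.1 hA
      have hAu : A ≠ Finset.univ := fun h => by
        have := Finset.card_le_card (Finset.mem_powerset.1 hAI)
        rw [h, Finset.card_univ, Fintype.card_fin] at this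
        omega
      rw [fhat_one_add_parity, if_neg hA0, if_neg hAu]
      ring
  refine ⟨fun y => ?_, ?_, ?_, fun I => ?_, fun I hI => (hlo I hI).trans_le hτ,
    fun e e' he hcard => ?_⟩
  · have := (abs_le.1 (abs_chi Finset.univ y).le).1
    nlinarith
  · rw [← fhat_empty, fhat_one_add_parity, if_pos rfl, if_neg hne]
    ring
  · have h1 : ∀ y : Cube m, |1 + δ * chi Finset.univ y - tilt (2 * δ) y| ≤
        δ * 1 + |tilt (2 * δ) y - 1| := fun y => by
      rw [show 1 + δ * chi Finset.univ y - tilt (2 * δ) y =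
        δ * chi Finset.univ y - (tilt (2 * δ) y - 1) by ring]
      refine (abs_sub _ _).trans ?_
      rw [abs_mul, abs_chi, abs_of_pos hδ0]
    refine (avg_mono h1).trans ?_
    rw [avg_add, avg_const_mul, avg_one]
    linarith [avg_abs_tilt_sub_one_le hm hδ0.le hδ]
  · by_cases hI : I = Finset.univ
    · rw [hI, Finset.sum_eq_single_of_mem Finset.univ (Finset.mem_erase.2 ⟨hne.symm, by simp⟩)]
      · rw [fhat_one_add_parity, if_neg hne.symm, if_pos rfl]
        simp
      · intro A hA hAu
        rw [fhat_one_add_parity, if_neg (Finset.mem_erase.1 hA).1, if_neg hAu]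
        ring
    · refine le_trans (Finset.sum_nonpos fun A hA => ?_) (sq_nonneg δ)
      obtain ⟨hA0, hAI⟩ := Finset.mem_erase.1 hA
      have hAu : A ≠ Finset.univ := fun h =>
        hI (Finset.eq_univ_iff_forall.2 fun i => Finset.mem_powerset.1 hAI (h ▸ Finset.mem_univ i))
      rw [fhat_one_add_parity, if_neg hA0, if_neg hAu]
      norm_num
  · refine ⟨fun x => chi Finset.univ (x ∘ e), fun x => (abs_chi _ _).le, ?_⟩
    have h1 := avg_comp e fun y => (1 + δ * chi Finset.univ y) * chi Finset.univ y
    have h2 := avg_comp_mul_comp he (chi Finset.univ) fun y => 1 + δ * chi Finset.univ y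
    have h3 := fhat_one_add_parity (δ := δ) (Finset.univ : Finset (Fin m))
    rw [if_neg hne.symm, if_pos rfl, fhat] at h3
    rw [Finset.sum_eq_zero fun A hA => by
      have hAu : Finset.univ ≠ A := fun h => by
        have := Finset.card_le_card (Finset.mem_powerset.1 hA)
        rw [← h, Finset.card_univ, Fintype.card_fin] at this
        omega
      rw [fhat, avg_chi_mul_chi, if_neg hAu, zero_mul]] at h2
    rw [h1, h3]
    simp_rw [mul_comm _ (chi Finset.univ (_ ∘ e))]
    rw [h2, zero_add, sub_zero, mul_one, abs_of_pos hδ0]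
    linarith

theorem abs_avg_mul_sub_avg_mul_le {M : ℕ} (e : Fin m ↪ Fin M) (g u : Cube m → ℝ)
    {φ : Cube M → ℝ} (hφ : ∀ x, |φ x| ≤ 1) :
    |avg (fun x => g (x ∘ e) * φ x) - avg (fun x => u (x ∘ e) * φ x)| ≤
      avg fun y => |g y - u y| := by
  rw [← avg_sub, ← avg_comp e fun y => |g y - u y|]
  refine (abs_avg_le _).trans (avg_mono fun x => ?_)
  rw [← sub_mul, abs_mul]
  exact mul_le_of_le_one_right (abs_nonneg _) (hφ x)

end parityAndBias

section mainTheorem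

/-- If `δ` is at least a constant times `ε`, a density without Fourier coefficients of degree
between `1` and `32 * k` is a hiding density. -/
theorem exists_isHidingDensity {m M t k : ℕ} (hk : 1 ≤ k) {a ε δ : ℝ} (hε : 0 < ε)
    (ha0 : 0 < a) (ha : a ≤ 1 / 2 ^ 22)
    (hδ : δ = a * (ε * √(Real.log (1 / ε)) / (k : ℝ) ^ 2)) (hδε : ε / 4 < δ)
    (hm : 1 / ε ≤ m) (hε2 : ε < 1 / 2) (htm : (t : ℝ) ≤ m / 2) :
    δ ≤ 1 / 8 ∧ ∃ g : Cube m → ℝ, IsHidingDensity M t δ ε 7 (((t : ℝ) / m) ^ (32 * k + 1) * 7) g := by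
  set S := √(Real.log (1 / ε)) with hS
  have hk1 : (1 : ℝ) ≤ k := by exact_mod_cast hk
  have hinv : 1 < 1 / ε := by rw [lt_div_iff₀ hε]; linarith
  have hlog : 0 < Real.log (1 / ε) := Real.log_pos hinv
  have hSsq : S ^ 2 = Real.log (1 / ε) := Real.sq_sqrt hlog.le
  have hS0 : 0 < S := Real.sqrt_pos.2 hlog
  have hexp : Real.exp (S ^ 2) = 1 / ε := by rw [hSsq, Real.exp_log (by positivity)]
  have hk2 : (0 : ℝ) < (k : ℝ) ^ 2 := by positivity
  have hδk : δ * (k : ℝ) ^ 2 = a * (ε * S) := by rw [hδ]; field_simp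
  have hδ0 : 0 < δ := by linarith
  have hSk : 2 ^ 20 * (k : ℝ) ^ 2 ≤ S := by
    have h1 : ε / 4 * (k : ℝ) ^ 2 ≤ 1 / 2 ^ 22 * (ε * S) := by
      calc ε / 4 * (k : ℝ) ^ 2 ≤ δ * (k : ℝ) ^ 2 := by gcongr
        _ = a * (ε * S) := hδk
        _ ≤ _ := by gcongr
    have h2 : ε * (2 ^ 20 * (k : ℝ) ^ 2) ≤ ε * S := by linarith
    exact le_of_mul_le_mul_left h2 hε
  have hkk : (k : ℝ) ≤ (k : ℝ) ^ 2 := le_self_pow₀ hk1 two_ne_zero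
  have hk21 : 1 ≤ (k : ℝ) ^ 2 := one_le_pow₀ hk1
  have hεS : ε * S ^ 2 ≤ 1 := by
    have := Real.add_one_le_exp (S ^ 2)
    rw [hexp] at this
    calc ε * S ^ 2 ≤ ε * (1 / ε) := by gcongr; linarith
      _ = 1 := by field_simp
  have hS1 : 2 ^ 20 ≤ S := by linarith
  have hδS : δ * S ≤ 1 / 2 ^ 22 := by
    calc δ * S ≤ δ * (k : ℝ) ^ 2 * S := by
          have : δ ≤ δ * (k : ℝ) ^ 2 := le_mul_of_one_le_right hδ0.le hk21
          gcongr
      _ = a * (ε * S ^ 2) := by rw [hδk]; ring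
      _ ≤ 1 / 2 ^ 22 * 1 := by gcongr
      _ = _ := mul_one _
  have hδ1 : δ ≤ 1 / 8 := by
    have : δ ≤ δ * S := le_mul_of_one_le_right hδ0.le (by linarith)
    linarith
  have hδ2 : δ ^ 2 ≤ (1 / 8) ^ 2 := pow_le_pow_left₀ hδ0.le hδ1 2
  have hm1 : (1 : ℝ) ≤ m := hinv.le.trans hm
  have hm0 : 0 < m := by exact_mod_cast (by linarith : (0 : ℝ) < m)
  set T := S / 4 with hT
  have hTk : 2 ^ 18 * (k : ℝ) ^ 2 ≤ T := by linarith
  have hT1 : 2 ^ 18 ≤ T := by linarith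
  have hTS : S ^ 2 = 16 * T ^ 2 := by rw [hT]; ring
  have hTm : T ^ 2 ≤ m := by
    have := Real.add_one_le_exp (S ^ 2)
    rw [hexp] at this
    linarith [sq_nonneg T]
  have hTT : T ≤ T ^ 2 := le_self_pow₀ (by linarith) two_ne_zero
  have hKT : ((32 * k : ℕ) : ℝ) ≤ T := by push_cast; linarith
  have hK1 : (1 : ℝ) ≤ ((32 * k : ℕ) : ℝ) := by push_cast; linarith
  have hKm : 32 * k ≤ m := by
    have : ((32 * k : ℕ) : ℝ) ≤ m := hKT.trans (hTT.trans hTm)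
    exact_mod_cast this
  have hexpT : Real.exp (6 * T ^ 2) ≤ 1 / ε := by
    rw [← hexp, hTS]
    exact Real.exp_le_exp.2 (by linarith [sq_nonneg T])
  have hexpT' : Real.exp (T ^ 2) ≤ 1 / ε :=
    (Real.exp_le_exp.2 (by linarith [sq_nonneg T])).trans hexpT
  obtain ⟨g, g0, g1, gK, gσ, gsq, gtv⟩ := exists_matching_density (m := m) (K := 32 * k)
    (T := T) (δ := δ) (l := ε / 64) (by omega) hKm (by linarith)
    (Real.le_sqrt_of_sq_le hTm) hδ0.le (by positivity) (by linarith)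
    (by
      rw [div_le_iff₀ (Real.sqrt_pos.2 (by linarith))]
      have := Real.one_le_sqrt.2 hm1
      linarith)
    (by
      have : δ * T ≤ 1 / 2 ^ 24 := by rw [hT]; linarith
      rw [mul_assoc]
      linarith)
    (by
      calc ε / 64 * Real.exp (6 * T ^ 2) ≤ ε / 64 * (1 / ε) := by gcongr
        _ = 1 / 64 := by field_simp
        _ ≤ 1 / 2 := by norm_num)
    (by
      have he : (2 : ℝ) ≤ Real.exp 1 := by linarith [Real.add_one_le_exp 1]
      set K := 32 * k with hK
      have h8 : (8 : ℝ) ≤ Real.exp 3 := by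
        have := pow_le_pow_left₀ zero_le_two he 3
        rw [← Real.exp_nat_mul] at this
        norm_num at this ⊢
        linarith
      have h9 : (9 : ℝ) ^ (K + 1) ≤ Real.exp (4 * (K + 1)) := by
        have h4 := pow_le_pow_left₀ zero_le_two he 4
        rw [← Real.exp_nat_mul] at h4
        norm_num at h4
        have := pow_le_pow_left₀ (by norm_num : (0 : ℝ) ≤ 9) (by linarith : 9 ≤ Real.exp 4) (K + 1)
        rw [← Real.exp_nat_mul] at this
        refine this.trans (le_of_eq ?_)
        push_cast
        rw [mul_comm]
      have hKK : (K : ℝ) ^ K ≤ Real.exp (K * K) := by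
        rw [Real.exp_nat_mul]
        gcongr
        linarith [Real.add_one_le_exp (K : ℝ)]
      calc 8 * 9 ^ (K + 1) * (K : ℝ) ^ K
          ≤ Real.exp 3 * Real.exp (4 * (K + 1)) * Real.exp (K * K) := by gcongr
        _ = Real.exp (3 + 4 * (K + 1) + K * K) := by rw [← Real.exp_add, ← Real.exp_add]
        _ ≤ _ := Real.exp_le_exp.2 (by
          have := mul_le_mul hKT hKT (by positivity) (by linarith)
          rw [← pow_two T] at this
          linarith))
    (by
      rw [div_le_iff₀ (by linarith)]
      have h1 : ((32 * k : ℕ) : ℝ) * (((32 * k : ℕ) : ℝ) + 1) ≤ 2 ^ 11 * (k : ℝ) ^ 2 := by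
        push_cast
        rw [show (32 : ℝ) * k * (32 * k + 1) = 1024 * (k : ℝ) ^ 2 + 32 * k by ring]
        linarith
      calc 4 * (((32 * k : ℕ) : ℝ) * (((32 * k : ℕ) : ℝ) + 1)) * δ
          ≤ 4 * (2 ^ 11 * (k : ℝ) ^ 2) * δ := by gcongr
        _ = 2 ^ 13 * (a * (ε * S)) := by rw [← hδk]; ring
        _ ≤ 2 ^ 13 * (1 / 2 ^ 22 * (ε * S)) := by gcongr
        _ = ε / 64 / 2 * T := by rw [hT]; ring)
  have gsq7 : avg (fun y => g y ^ 2) ≤ 7 := by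
    refine gsq.trans ?_
    have h1 : Real.exp (4 * δ ^ 2) ≤ Real.exp 1 := Real.exp_le_exp.2 (by linarith)
    have h2 := Real.exp_one_lt_d9
    have h3 : 8 * (ε / 64) ^ 2 * Real.exp (T ^ 2) ≤ 8 * (ε / 64) ^ 2 * (1 / ε) := by gcongr
    have h4 : 8 * (ε / 64) ^ 2 * (1 / ε) = ε / 512 := by field_simp; norm_num
    linarith
  have hsum := sum_fhat_sq_le_of_card hm0 gσ gK
  refine ⟨hδ1, g, g0, g1, gtv.trans (by linarith), fun I => ?_, fun I hI => ?_, fun e e' he hcard => ?_⟩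
  · refine le_trans ?_ gsq7
    rw [parseval]
    exact Finset.sum_le_sum_of_subset_of_nonneg (Finset.subset_univ _) fun A _ _ => sq_nonneg _
  · refine (hsum I).trans ?_
    have h0 : (I.card : ℝ) / m ≤ t / m :=
      div_le_div_of_nonneg_right (Nat.cast_le.2 hI) (by linarith)
    exact mul_le_mul (pow_le_pow_left₀ (div_nonneg (Nat.cast_nonneg _) (Nat.cast_nonneg _)) h0 _) gsq7
      (avg_nonneg fun y => sq_nonneg _) (pow_nonneg (div_nonneg (Nat.cast_nonneg _) (Nat.cast_nonneg _)) _)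
  · obtain ⟨φ, hφ, h⟩ := exists_test_of_agree_le hm0 hδ0.le hδ1 he
      ((Nat.cast_le.2 hcard).trans htm)
    refine ⟨φ, hφ, lt_of_lt_of_le ?_ (le_abs_self _)⟩
    have h1 := (abs_le.1 ((abs_avg_mul_sub_avg_mul_le e g (tilt (2 * δ)) hφ).trans gtv)).1
    have h2 := (abs_le.1 ((abs_avg_mul_sub_avg_mul_le e' g (tilt (2 * δ)) hφ).trans gtv)).2
    linarith

/-- The number of words of length `q ^ 8` that agree with a given one in many places is small
compared with the number of queries in the lower bound. -/
theorem query_bound_aux {q Y : ℝ} (hq : 3 ≤ q) (hY : Y ≤ q ^ 4 / 2) :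
    (2 : ℝ) ^ Y * q ^ 8 * 2 ^ (-q ^ 6) ≤ 1 / 6 := by
  have hs : 81 ≤ q ^ 4 := by
    calc (81 : ℝ) = 3 ^ 4 := by norm_num
      _ ≤ q ^ 4 := by gcongr
  set s := q ^ 4 with hsdef
  have h6 : 9 * s ≤ q ^ 6 := by
    calc 9 * s = 3 ^ 2 * q ^ 4 := by rw [hsdef]; norm_num
      _ ≤ q ^ 2 * q ^ 4 := by gcongr
      _ = q ^ 6 := by ring
  have h1 : (2 : ℝ) ^ Y * q ^ 8 * 2 ^ (-q ^ 6) = s ^ 2 * 2 ^ (Y - q ^ 6) := by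
    rw [sub_eq_add_neg, Real.rpow_add two_pos, hsdef]
    ring
  have h2 : (2 : ℝ) ^ (Y - q ^ 6) ≤ 2 ^ (-(2 * s)) :=
    Real.rpow_le_rpow_of_exponent_le one_le_two (by linarith)
  have h3 : Real.exp s ≤ (2 : ℝ) ^ (2 * s) := by
    rw [Real.rpow_def_of_pos two_pos]
    refine Real.exp_le_exp.2 ?_
    have := Real.log_two_gt_d9
    nlinarith
  have h4 : s ^ 3 / 6 ≤ Real.exp s := by
    have := Real.pow_div_factorial_le_exp s (by linarith) 3
    norm_num [Nat.factorial] at this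
    exact this
  rw [h1]
  refine (mul_le_mul_of_nonneg_left h2 (by positivity)).trans ?_
  rw [Real.rpow_neg two_pos.le, ← div_eq_mul_inv, div_le_iff₀ (by positivity)]
  nlinarith [sq_nonneg s]

theorem exists_eighth_root {m M : ℕ} (hm : 10 ^ 5 ≤ m)
    (hM : (M : ℝ) = 3 * (m : ℝ) ^ (5 / 4 : ℝ)) :
    ∃ q : ℝ, 3 ≤ q ∧ (m : ℝ) = q ^ 8 ∧ (M : ℝ) = 3 * q ^ 10 := by
  have hm0 : (0 : ℝ) ≤ m := Nat.cast_nonneg m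
  have h8 : (m : ℝ) = ((m : ℝ) ^ (1 / 8 : ℝ)) ^ 8 := by
    rw [← Real.rpow_natCast, ← Real.rpow_mul hm0]
    norm_num
  refine ⟨(m : ℝ) ^ (1 / 8 : ℝ), ?_, h8, ?_⟩
  · have hm' : (10 : ℝ) ^ 5 ≤ m := by exact_mod_cast hm
    rw [h8] at hm'
    by_contra! h
    have := pow_lt_pow_left₀ h (by positivity) (by norm_num : 8 ≠ 0)
    norm_num at this hm'
    linarith
  · rw [hM, ← Real.rpow_natCast, ← Real.rpow_mul hm0]
    norm_num

theorem IsHidingDensity.mono {m M t : ℕ} {δ ε β τ τ' : ℝ} {g : Cube m → ℝ}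
    (h : IsHidingDensity M t δ ε β τ g) (hτ : τ ≤ τ') : IsHidingDensity M t δ ε β τ' g := by
  obtain ⟨h0, h1, h2, h3, h4, h5⟩ := h
  exact ⟨h0, h1, h2, h3, fun I hI => (h4 I hI).trans hτ, h5⟩

theorem inv_pow_le_rpow {M k : ℕ} {q : ℝ} (hq : 3 ≤ q) (hM : (M : ℝ) = 3 * q ^ 10) :
    (1 / q) ^ (4 * k + 4) ≤ (M : ℝ) ^ (-((k : ℝ) + 1) / 5) := by
  have hq0 : 0 < q := by linarith
  have h1 : (M : ℝ) ≤ q ^ 20 := by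
    rw [hM]
    calc 3 * q ^ 10 ≤ q ^ 10 * q ^ 10 := by
          have : q ≤ q ^ 10 := le_self_pow₀ (by linarith) (by norm_num)
          gcongr
          linarith
      _ = q ^ 20 := by ring
  have hM0 : (0 : ℝ) < M := by rw [hM]; positivity
  have h2 : -((k : ℝ) + 1) / 5 ≤ 0 := by
    have : (0 : ℝ) ≤ k := Nat.cast_nonneg k
    linarith
  refine le_trans (le_of_eq ?_) (Real.rpow_le_rpow_of_nonpos hM0 h1 h2)
  rw [← Real.rpow_natCast q 20, ← Real.rpow_mul hq0.le, one_div, inv_pow, ← Real.rpow_natCast,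
    ← Real.rpow_neg hq0.le]
  congr 1
  push_cast
  ring

theorem rpow_two_fifths_le {M : ℕ} {q : ℝ} (hq : 3 ≤ q) (hM : (M : ℝ) = 3 * q ^ 10) :
    (M : ℝ) ^ (2 / 5 : ℝ) ≤ 2 * q ^ 4 := by
  have hM0 : (0 : ℝ) ≤ M := Nat.cast_nonneg M
  have h1 : (M : ℝ) ^ 2 ≤ (2 * q ^ 4) ^ 5 := by
    rw [hM]
    have : 0 ≤ q ^ 20 := by positivity
    nlinarith
  have h2 : (M : ℝ) ^ (2 / 5 : ℝ) = ((M : ℝ) ^ 2) ^ (1 / 5 : ℝ) := by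
    rw [← Real.rpow_natCast, ← Real.rpow_mul hM0]
    norm_num
  have h3 : ((2 * q ^ 4) ^ 5) ^ (1 / 5 : ℝ) = 2 * q ^ 4 := by
    rw [← Real.rpow_natCast, ← Real.rpow_mul (by positivity)]
    norm_num
  rw [h2, ← h3]
  exact Real.rpow_le_rpow (by positivity) h1 (by norm_num)

theorem words_bound_aux {m L t : ℕ} {q : ℝ} (hq : 3 ≤ q) (hm : (m : ℝ) = q ^ 8)
    (hL : 2 * q ^ 2 ≤ L) (ht : 2 * q ^ 6 ≤ t) :
    ((L : ℝ) + 1) ^ m ≤ (L : ℝ) ^ m * 2 ^ (-q ^ 6) * 2 ^ t := by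
  have hL0 : (0 : ℝ) < L := by
    have : 0 < q ^ 2 := by positivity
    linarith
  have h1 : ((L : ℝ) + 1) ^ m ≤ (L : ℝ) ^ m * Real.exp (q ^ 6 / 2) := by
    calc ((L : ℝ) + 1) ^ m = (L : ℝ) ^ m * (1 / L + 1) ^ m := by
          rw [← mul_pow]
          congr 1
          field_simp
          ring
      _ ≤ (L : ℝ) ^ m * Real.exp (1 / L) ^ m := by
          gcongr
          exact Real.add_one_le_exp _
      _ ≤ (L : ℝ) ^ m * Real.exp (q ^ 6 / 2) := by
          rw [← Real.exp_nat_mul]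
          gcongr
          rw [hm, mul_one_div, div_le_iff₀ hL0]
          calc q ^ 8 = q ^ 6 / 2 * (2 * q ^ 2) := by ring
            _ ≤ q ^ 6 / 2 * L := by gcongr
  have h2 : Real.exp (q ^ 6 / 2) ≤ 2 ^ (-q ^ 6) * 2 ^ t := by
    rw [← Real.rpow_natCast 2 t, ← Real.rpow_add two_pos, Real.rpow_def_of_pos two_pos]
    refine Real.exp_le_exp.2 ?_
    have h3 := Real.log_two_gt_d9
    have h4 : 0 ≤ q ^ 6 := by positivity
    calc q ^ 6 / 2 ≤ Real.log 2 * q ^ 6 := by nlinarith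
      _ ≤ Real.log 2 * (-q ^ 6 + t) := by
        gcongr
        linarith
  rw [mul_assoc]
  exact h1.trans (by gcongr)

open MeasureTheory in
theorem theoremB2 :
    ∃ (k₀ : ℕ) (a₀ κ c : ℝ), 0 < a₀ ∧ 0 < κ ∧ 0 < c ∧
      ∀ b : ℝ, 0 < b → ∃ C' : ℝ, 0 < C' ∧
        ∀ (k m M : ℕ) (a ε δ τ : ℝ),
          k₀ ≤ k →
          (M : ℝ) = 3 * (m : ℝ) ^ (5 / 4 : ℝ) →
          0 < ε → ε < 1 / 2 →
          0 < a → a ≤ a₀ →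
          δ = a * (ε * √(Real.log (1 / ε)) / (k : ℝ) ^ 2) →
          b * ((M : ℝ) ^ (-((k : ℝ) + 1) / 5) * δ) ≤ τ →
          max (C' / ε) ((k : ℝ) ^ 2 / Real.log (1 / δ)) < (m : ℝ) →
          ∀ (Ω : Type*) [MeasurableSpace Ω] (ν : Measure Ω) [IsProbabilityMeasure ν]
            (A : Ω → SQAlg M),
            LearnsWithProb ν A (corruptedClass M m (δ / √(m : ℝ)) ε) (κ * δ) (2 / 3) →
            ∃ P ∈ corruptedClass M m (δ / √(m : ℝ)) ε,
              ∃ O : StatQuery M → ℝ, IsStatOracle P O ∧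
                ∃ᵐ ω ∂ν,
                  (∃ q ∈ (A ω).queries O, q.tol < √(2 * τ)) ∨
                  (2 : ℝ) ^ (c * (M : ℝ) ^ (2 / 5 : ℝ)) * (M : ℝ) ^ (-((k : ℝ) + 1) / 5) ≤
                    (((A ω).queries O).length : ℝ) := by
  refine ⟨1, 1 / 2 ^ 22, 1 / 32, 1 / 4, by norm_num, by norm_num, by norm_num, fun b hb =>
    ⟨28 / b + 10 ^ 5, by positivity, ?_⟩⟩
  intro k m M a ε δ τ hk hM hε hε2 ha0 ha hδ hτ hmax Ω _ ν _ A hA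
  -- the size of `m`
  have hmC : (28 / b + 10 ^ 5) / ε < m := (le_max_left _ _).trans_lt hmax
  have hb28 : 0 < 28 / b := by positivity
  have hm1 : 28 / b + 10 ^ 5 < m := by
    refine lt_of_le_of_lt ?_ hmC
    rw [le_div_iff₀ hε]
    nlinarith
  have hmε : 1 / ε ≤ m := by
    refine le_trans ?_ hmC.le
    gcongr
    linarith
  have hmb : 28 ≤ b * ε * m := by
    have h1 : 28 / b / ε ≤ m := by
      refine le_trans ?_ hmC.le
      gcongr
      linarith
    rw [div_div, div_le_iff₀ (by positivity)] at h1
    linarith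
  have hm5 : 10 ^ 5 ≤ m := by exact_mod_cast (by linarith : (10 : ℝ) ^ 5 ≤ m)
  have hk1 : (1 : ℝ) ≤ k := by exact_mod_cast hk
  have hlog : 0 < Real.log (1 / ε) := Real.log_pos (by rw [lt_div_iff₀ hε]; linarith)
  have hδ0 : 0 < δ := by
    rw [hδ]
    have := Real.sqrt_pos.2 hlog
    positivity
  obtain ⟨q, hq, hmq, hMq⟩ := exists_eighth_root hm5 hM
  have hq0 : 0 < q := by linarith
  have hq6 : 1 ≤ q ^ 6 := one_le_pow₀ (by linarith)
  -- the size of the alphabet and the number of agreements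
  set L := ⌊3 * q ^ 2⌋₊ with hL
  set t := ⌈2 * q ^ 6⌉₊ with ht
  have hL1 : 2 * q ^ 2 ≤ L := by
    have := Nat.lt_floor_add_one (3 * q ^ 2)
    rw [← hL] at this
    have : 1 ≤ q ^ 2 := one_le_pow₀ (by linarith)
    linarith
  have hL2 : (L : ℝ) ≤ 3 * q ^ 2 := Nat.floor_le (by positivity)
  have hL0 : 0 < L := by
    have : (0 : ℝ) < L := lt_of_lt_of_le (by positivity) hL1
    exact_mod_cast this
  have hML : m * L ≤ M := by
    have : (m : ℝ) * L ≤ M := by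
      calc (m : ℝ) * L ≤ q ^ 8 * (3 * q ^ 2) := by rw [hmq]; gcongr
        _ = M := by rw [hMq]; ring
    exact_mod_cast this
  have ht1 : 2 * q ^ 6 ≤ t := Nat.le_ceil _
  have ht2 : (t : ℝ) ≤ q ^ 7 := by
    have := Nat.ceil_lt_add_one (by positivity : 0 ≤ 2 * q ^ 6)
    calc (t : ℝ) ≤ 3 * q ^ 6 := by linarith
      _ ≤ q * q ^ 6 := by gcongr
      _ = q ^ 7 := by ring
  have htm : (t : ℝ) ≤ m / 2 := by
    rw [hmq]
    have : 2 * q ^ 7 ≤ q * q ^ 7 := by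
      gcongr
      linarith
    calc (t : ℝ) ≤ q ^ 7 := ht2
      _ ≤ q * q ^ 7 / 2 := by linarith
      _ = q ^ 8 / 2 := by ring
  have htm' : t < m := by
    have : (t : ℝ) < m := by linarith
    exact_mod_cast this
  set E := (M : ℝ) ^ (-((k : ℝ) + 1) / 5) with hE
  have hM0 : (0 : ℝ) < M := by rw [hMq]; positivity
  have hE0 : 0 < E := Real.rpow_pos_of_pos hM0 _
  have hτ0 : 0 < b * (E * δ) := by positivity
  obtain ⟨hδ1, g, β, hg, hβ⟩ : δ ≤ 1 / 8 ∧ ∃ (g : Cube m → ℝ) (β : ℝ),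
      IsHidingDensity M t δ ε β (b * (E * δ)) g ∧ β ≤ b * δ * q ^ 8 := by
    rcases le_or_gt δ (ε / 4) with hδε | hδε
    · have hδ1 : δ ≤ 1 / 8 := by linarith
      refine ⟨hδ1, _, _, isHidingDensity_parity htm' hδ0 hδ1 (by linarith) hτ0.le, ?_⟩
      rw [← hmq, pow_two, mul_right_comm]
      gcongr
      have : b * ε * m ≤ b * 1 * m := by
        gcongr
        linarith
      linarith
    · obtain ⟨hδ1, g, hg⟩ := exists_isHidingDensity (M := M) hk hε ha0 ha hδ hδε hmε hε2 htm
      have hβ : 7 ≤ b * δ * q ^ 8 := by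
        rw [← hmq]
        have : b * (ε / 4) * m ≤ b * δ * m := by gcongr
        linarith
      refine ⟨hδ1, g, 7, hg.mono ?_, hβ⟩
      have hq1 : 1 / q ≤ 1 := by
        rw [div_le_one hq0]
        linarith
      have htq : (t : ℝ) / m ≤ 1 / q := by
        rw [hmq, div_le_div_iff₀ (by positivity) hq0]
        calc (t : ℝ) * q ≤ q ^ 7 * q := by gcongr
          _ = 1 * q ^ 8 := by ring
      have ht0 : 0 ≤ (t : ℝ) / m := div_nonneg (Nat.cast_nonneg _) (Nat.cast_nonneg _)
      calc ((t : ℝ) / m) ^ (32 * k + 1) * 7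
          ≤ (1 / q) ^ (4 * k + 4 + 8) * (b * δ * q ^ 8) := by
            refine mul_le_mul ?_ hβ (by norm_num) (by positivity)
            exact (pow_le_pow_left₀ ht0 htq _).trans
              (pow_le_pow_of_le_one (by positivity) hq1 (by omega))
        _ = (1 / q) ^ (4 * k + 4) * (b * δ) := by
            rw [pow_add, one_div, inv_pow q 8]
            field_simp
        _ ≤ E * (b * δ) := by
            gcongr
            exact inv_pow_le_rpow hq hMq
        _ = b * (E * δ) := by ring
  have hsmall : δ / √(m : ℝ) ≤ 1 / 2 := by
    have h1 : 1 ≤ √(m : ℝ) := Real.one_le_sqrt.2 (by linarith)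
    rw [div_le_iff₀ (by linarith)]
    linarith
  obtain ⟨g0, g1, gε, gβ, gτ, gfar⟩ := hg
  have hW6 : (2 : ℝ) ^ (-q ^ 6) ≤ 1 / 6 := by
    have h := query_bound_aux (Y := 0) hq (by positivity)
    rw [Real.rpow_zero, one_mul] at h
    refine le_trans (le_mul_of_one_le_left (by positivity) (one_le_pow₀ (by linarith))) h
  refine exists_oracle_of_density (t := t) hL0 hML g0 g1 hτ0 hτ gβ gτ (W := L ^ m * 2 ^ (-q ^ 6))
    (fun e e' he hcard => ?_) (fun e => ?_) (words_bound_aux hq hmq hL1 ht1) ?_ (by positivity) ?_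
    ν A hA
  · obtain ⟨φ, hφ, h⟩ := gfar e e' he hcard
    exact ⟨φ, hφ, by linarith⟩
  · refine ⟨Finset.univ.map e, by simp, ?_⟩
    refine (tvDist_densityPMF_le _ _ _ _ (fun x => tilt (2 * δ) (x ∘ e))
      (shiftedUniform_map_apply e hδ0.le hsmall)).trans ?_
    exact (avg_comp e fun y => |g y - tilt (2 * δ) y|).trans_le gε
  · rw [div_eq_mul_one_div]
    gcongr
  · set Y := 1 / 4 * (M : ℝ) ^ (2 / 5 : ℝ) with hY
    have hY4 : Y ≤ q ^ 4 / 2 := by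
      have := rpow_two_fifths_le hq hMq
      rw [hY]
      linarith
    calc 2 ^ Y * E * (L ^ m * 2 ^ (-q ^ 6) * β / (b * (E * δ)))
        = L ^ m * (2 ^ Y * (β / (b * δ)) * 2 ^ (-q ^ 6)) := by field_simp
      _ ≤ L ^ m * (2 ^ Y * q ^ 8 * 2 ^ (-q ^ 6)) := by
          gcongr
          rw [div_le_iff₀ (by positivity)]
          linarith
      _ ≤ L ^ m * (1 / 6) := by
          gcongr
          exact query_bound_aux hq hY4
      _ = L ^ m / 6 := by ring

end mainTheorem
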